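/- **Setting.** Let $\mathcal T$ be a many-sorted first-order theory given by a signature $\Sigma$ and a structure with nonempty carriers $D_s$. Formulas are built from predicate symbols of $\Sigma$ and predicate variables, applied to terms, by $\neg,\vee,\wedge,\exists x{:}s,\forall x{:}s$; terms are built from term variables, function symbols and function variables. A *$\mu$CLP* is a finite sequence of equations $$\mathcal P=(X_1(\tilde x_1)=_{\alpha_1}\phi_1);\dots;(X_m(\tilde x_m)=_{\alpha_m}\phi_m),\qquad \alpha_i\in\{\mu,\nu\},\ m\ge 0,$$ where the free term variables of $\phi_i$ are among $\tilde x_i$, the only predicate variables of $\phi_i$ are $X_1,\dots,X_m$, all of whose occurrences are positive (under an even number of negations), and $\phi_i$ has no function variables. A *query* $\varphi$ is a formula without function variables, whose predicate variables are among the $X_i$ and occur only positively; it may have free term variables. The semantics is $[\![\epsilon]\!](\rho)=\emptyset$ and $$[\![(X(\tilde x)=_\alpha\phi);\mathcal P']\!](\rho)=\{X\mapsto q^*\}\uplus[\![\mathcal P']\!](\rho\uplus\{X\mapsto q^*\}),$$ where $q^*$ is the least ($\alpha=\mu$) or greatest ($\alpha=\nu$) fixpoint of $q\mapsto\lambda\tilde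 v.\,[\![\phi]\!]\bigl(\rho\{X\mapsto q,\tilde x\mapsto\tilde v\}\uplus[\![\mathcal P']\!](\rho\{X\mapsto q\})\bigr)$. Write $\mathcal P\models\varphi$ if $\varphi$ holds under $[\![\mathcal P]\!](\emptyset)$ for all values of its free term variables. **Target problems.** A *clause* is $\psi\vee\bigvee_i Y_i(\tilde t_i)\vee\bigvee_j\neg Y_j(\tilde t_j)$ with predicate variables $Y_i,Y_j$ and $\psi$ without quantifiers and predicate variables (function variables are allowed); its term variables are implicitly universally quantified. A *pCSP* $(\mathcal C,\mathcal R)$ is a finite set $\mathcal C$ of clauses with a set $\mathcal R$ of predicate variables. A *semantic solution* is an interpretation of the function variables by total functions and of the predicate variables by predicates that makes all clauses of $\mathcal C$ true and in which each $R\in\mathcal R$ is well-founded: $R$ has argument sorts $(\tilde s,\tilde s)$ and there is no infinite sequence $\tilde v_1,\tilde v_2,\dots$ with $R(\tilde v_i,\tilde v_{i+1})$ for all $i\geq 1$. **Reduction.** $\mathrm{Reduct}(\varphi,\mathcal P)$ is a pCSP over $\mathcal T$ extended by a Boolean sort (with constants $\top,\bot$ and Boolean terms usable as atoms) and by a dummy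 constant of each sort, interpreted by an arbitrary value. It is computed in three steps. 1. $\mathrm{elim}_\exists$: in $\varphi$ and all $\phi_i$, Skolemize the positive occurrences of $\exists$ and the negative occurrences of $\forall$. Each such occurrence gets a fresh function variable, applied to the free variables of the query (resp. the formal arguments $\tilde x_i$) and the enclosing quantified variables that have not themselves been Skolemized. 2. $\mathrm{elim}_\mu$: as long as there is a $\mu$-equation, take the right-most one, so that the $\mu$CLP is $\mathcal P_0;(X(\tilde x)=_\mu\phi');(X_i(\tilde x_i)=_\nu\phi_i)_{i=1}^{n}$ (here $X_1,\dots,X_n$ denote the predicates to the right of $X$). Add a fresh predicate variable $R_X$ to $\mathcal R$ (initially empty) and replace the query $\varphi$ by $\sigma_0(\varphi)$ and the $\mu$CLP by $$\sigma_0(\mathcal P_0);\ (X(\tilde x)=_\nu\sigma_X(\phi'));\ (X_i(b_i,\tilde x,\tilde x_i)=_\nu\sigma_i(\phi_i))_{i=1}^{n},$$ where the $b_i$ are fresh Boolean variables, $\tilde d$ is the tuple of dummy constants, and - $\sigma_0$ replaces each $X_j$ by $\lambda\tilde y.\,X_j(\bot,\tilde d,\tilde y)$; - $\sigma_X$ replaces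 $X$ by $\lambda\tilde y.\,X(\tilde y)\wedge R_X(\tilde x,\tilde y)$ and each $X_j$ by $\lambda\tilde y.\,X_j(\top,\tilde x,\tilde y)$; - $\sigma_i$ replaces $X$ by $\lambda\tilde y.\,X(\tilde y)\wedge(b_i\Rightarrow R_X(\tilde x,\tilde y))$ and each $X_j$ by $\lambda\tilde y.\,X_j(b_i,\tilde x,\tilde y)$. 3. $\mathrm{elim}_\nu$: regard the defined predicates of the resulting $\nu$-only $\mu$CLP as uninterpreted predicate variables. Let $\mathcal C$ consist of the clauses of the prenex conjunctive normal forms of the query and of $X(\tilde x)\Rightarrow\phi$ for each equation $X(\tilde x)=_\nu\phi$. The result is $\mathrm{Reduct}(\varphi,\mathcal P)=(\mathcal C,\mathcal R)$. **Theorem.** For every $\mu$CLP $\mathcal P$ and query $\varphi$ as above, $\mathrm{Reduct}(\varphi,\mathcal P)$ has a semantic solution if and only if $\mathcal P\models\varphi$. -/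

import Mathlib

universe u v

namespace MuVal

/-! ## Sorted variables and tuples -/

/-- `Var Γ s`: the positions of the list of sorts `Γ` that carry the sort `s`, that is, the
variables of sort `s` in the context `Γ` (de Bruijn indices). -/
inductive Var {S : Type u} : List S → S → Type u
  | zero {s : S} {Γ : List S} : Var (s :: Γ) s
  | succ {s t : S} {Γ : List S} (x : Var Γ t) : Var (s :: Γ) t

namespace Var
variable {S : Type u}

/-- The variables of `Γ` inside `Γ ++ Δ`. -/
def inl {Δ : List S} {t : S} : {Γ : List S} → Var Γ t → Var (Γ ++ Δ) t
  | _ :: _, .zero => .zero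
  | _ :: _, .succ x => .succ x.inl

/-- The variables of `Δ` inside `Γ ++ Δ`. -/
def inr {Δ : List S} {t : S} : (Γ : List S) → Var Δ t → Var (Γ ++ Δ) t
  | [], x => x
  | _ :: Γ, x => .succ (inr Γ x)

/-- Transport of a variable along an equality of contexts. -/
def cast {Γ Δ : List S} {t : S} (h : Γ = Δ) (x : Var Γ t) : Var Δ t := h ▸ x

end Var

/-- Tuples indexed by a context: one entry in `D t` for each variable of sort `t`.
With `D` the carriers of a structure these are the tuples of values of the given sorts
(environments); with `D` the terms over a context they are tuples of argument terms
(simultaneous substitutions). -/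
def Tup {S : Type u} (D : S → Type v) (Γ : List S) : Type (max u v) :=
  (t : S) → Var Γ t → D t

namespace Tup
variable {S : Type u} {D : S → Type v}

def nil : Tup D [] := fun _ x => nomatch x

def cons {s : S} {Γ : List S} (a : D s) (e : Tup D Γ) : Tup D (s :: Γ)
  | _, .zero => a
  | _, .succ x => e _ x

def tail {s : S} {Γ : List S} (e : Tup D (s :: Γ)) : Tup D Γ := fun _ x => e _ (.succ x)

def append {Δ : List S} : {Γ : List S} → Tup D Γ → Tup D Δ → Tup D (Γ ++ Δ)
  | [], _, e => e
  | _ :: _, d, e => cons (d _ .zero) (append d.tail e)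

def cast {Γ Δ : List S} (h : Γ = Δ) (e : Tup D Γ) : Tup D Δ := h ▸ e

/-- A tuple over `Γ`, read as a tuple over the image of `Γ` in an enlarged set of sorts. -/
def mapSome {D : Option S → Type v} :
    {Γ : List S} → Tup (fun t => D (some t)) Γ → Tup D (Γ.map some)
  | [], _ => nil
  | _ :: _, e => cons (e _ .zero) (mapSome e.tail)

/-- The converse of `mapSome`. -/
def unmapSome {D : Option S → Type v} :
    {Γ : List S} → Tup D (Γ.map some) → Tup (fun t => D (some t)) Γ
  | [], _ => nil
  | _ :: _, e => cons (e _ .zero) (unmapSome e.tail)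

end Tup

/-! ## Signatures, structures, terms and formulas -/

/-- A many-sorted first-order signature: `Fn w s` are the function symbols of sort `w → s`
(constants if `w = []`) and `Pr w` the predicate symbols with argument sorts `w`. -/
structure Signature where
  Srt : Type u
  Fn : List Srt → Srt → Type u
  Pr : List Srt → Type u

/-- A structure for a signature; as usual all carriers are nonempty. -/
structure Struc (L : Signature.{u}) where
  carrier : L.Srt → Type v
  nonempty : ∀ s, Nonempty (carrier s)
  fnI : ∀ {w s}, L.Fn w s → Tup carrier w → carrier s
  prI : ∀ {w}, L.Pr w → Tup carrier w → Prop

/-- A family of function variables: `FV w s` are the function variables of sort `w → s`. -/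
abbrev FunVars (S : Type u) := List S → S → Type u

/-- No function variables. -/
abbrev noFV (S : Type u) : FunVars S := fun _ _ => PEmpty

/-- A family of predicate variables, together with their argument sorts. -/
structure PredVars (S : Type u) where
  Idx : Type
  ar : Idx → List S

section Formulas

/-- Terms over the term variables `Γ` and the function variables `FV`. -/
inductive Term (L : Signature.{u}) (FV : FunVars L.Srt) (Γ : List L.Srt) : L.Srt → Type u
  | var {s} (x : Var Γ s) : Term L FV Γ s
  | fvar {w s} (F : FV w s) (args : (t : L.Srt) → Var w t → Term L FV Γ t) : Term L FV Γ s
  | fn {w s} (f : L.Fn w s) (args : (t : L.Srt) → Var w t → Term L FV Γ t) : Term L FV Γ s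

/-- Tuples of terms of sorts `w` over `Γ`; also the substitutions for the variables of `w`. -/
abbrev Terms (L : Signature.{u}) (FV : FunVars L.Srt) (w Γ : List L.Srt) : Type u :=
  Tup (Term L FV Γ) w

/-- Formulas over the term variables `Γ`, the function variables `FV` and the predicate
variables `PV`. -/
inductive Formula (L : Signature.{u}) (FV : FunVars L.Srt) (PV : PredVars L.Srt) :
    List L.Srt → Type u
  | pvar {Γ} (X : PV.Idx) (args : Terms L FV (PV.ar X) Γ) : Formula L FV PV Γ
  | atom {Γ w} (p : L.Pr w) (args : Terms L FV w Γ) : Formula L FV PV Γ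
  | neg {Γ} (φ : Formula L FV PV Γ) : Formula L FV PV Γ
  | or {Γ} (φ ψ : Formula L FV PV Γ) : Formula L FV PV Γ
  | and {Γ} (φ ψ : Formula L FV PV Γ) : Formula L FV PV Γ
  | ex {Γ} (s : L.Srt) (φ : Formula L FV PV (s :: Γ)) : Formula L FV PV Γ
  | all {Γ} (s : L.Srt) (φ : Formula L FV PV (s :: Γ)) : Formula L FV PV Γ

end Formulas

variable {L : Signature.{u}} {FV : FunVars L.Srt} {PV PV' : PredVars L.Srt}
  {Γ Δ Θ : List L.Srt}

/-- Substitution of terms for term variables. -/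
def Term.subst (θ : Terms L FV Γ Δ) : {s : L.Srt} → Term L FV Γ s → Term L FV Δ s
  | _, .var x => θ _ x
  | _, .fvar F args => .fvar F fun t x => (args t x).subst θ
  | _, .fn f args => .fn f fun t x => (args t x).subst θ

/-- A term without function variables, as a term over any function variables. -/
def Term.ofClosed : {s : L.Srt} → Term L (noFV L.Srt) Γ s → Term L FV Γ s
  | _, .var x => .var x
  | _, .fvar F _ => nomatch F
  | _, .fn f args => .fn f fun t x => (args t x).ofClosed

namespace Terms

/-- The identity substitution, i.e. the tuple of all variables of the context. -/
def id : Terms L FV Γ Γ := fun _ x => .var x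

def subst {w : List L.Srt} (ts : Terms L FV w Γ) (θ : Terms L FV Γ Δ) : Terms L FV w Δ :=
  fun t x => (ts t x).subst θ

/-- Weakening by one variable. -/
def weaken {w : List L.Srt} {s : L.Srt} (ts : Terms L FV w Γ) : Terms L FV w (s :: Γ) :=
  ts.subst fun _ x => .var x.succ

/-- A substitution below a binder. -/
def lift {s : L.Srt} (θ : Terms L FV Γ Δ) : Terms L FV (s :: Γ) (s :: Δ) :=
  Tup.cons (.var .zero) θ.weaken

def ofClosed {w : List L.Srt} (ts : Terms L (noFV L.Srt) w Γ) : Terms L FV w Γ :=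
  fun t x => (ts t x).ofClosed

/-- The variables of the left, resp. right, part of a context. -/
def inl : Terms L FV Γ (Γ ++ Δ) := fun _ x => .var x.inl
def inr : Terms L FV Δ (Γ ++ Δ) := fun _ x => .var (x.inr Γ)

end Terms

namespace Formula

/-- Substitution of terms for the free term variables. -/
def subst : {Γ Δ : List L.Srt} → Formula L FV PV Γ → Terms L FV Γ Δ → Formula L FV PV Δ
  | _, _, .pvar X args, θ => .pvar X (args.subst θ)
  | _, _, .atom p args, θ => .atom p (args.subst θ)
  | _, _, .neg φ, θ => .neg (φ.subst θ)
  | _, _, .or φ ψ, θ => .or (φ.subst θ) (ψ.subst θ)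
  | _, _, .and φ ψ, θ => .and (φ.subst θ) (ψ.subst θ)
  | _, _, .ex s φ, θ => .ex s (φ.subst θ.lift)
  | _, _, .all s φ, θ => .all s (φ.subst θ.lift)

/-- Substitution of predicates for predicate variables. Each `X` is replaced by
`λ y. σ X`, where `σ X` may mention, besides `y`, parameters `Θ`. The terms `π` are plugged in
for the parameters, and at the same time `θ` for the free term variables. -/
def psubst (σ : (X : PV.Idx) → Formula L FV PV' (PV.ar X ++ Θ)) :
    {Γ Δ : List L.Srt} → Formula L FV PV Γ → Terms L FV Γ Δ → Terms L FV Θ Δ →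
      Formula L FV PV' Δ
  | _, _, .pvar X args, θ, π => (σ X).subst (Tup.append (args.subst θ) π)
  | _, _, .atom p args, θ, _ => .atom p (args.subst θ)
  | _, _, .neg φ, θ, π => .neg (φ.psubst σ θ π)
  | _, _, .or φ ψ, θ, π => .or (φ.psubst σ θ π) (ψ.psubst σ θ π)
  | _, _, .and φ ψ, θ, π => .and (φ.psubst σ θ π) (ψ.psubst σ θ π)
  | _, _, .ex s φ, θ, π => .ex s (φ.psubst σ θ.lift π.weaken)
  | _, _, .all s φ, θ, π => .all s (φ.psubst σ θ.lift π.weaken)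

/-- `φ.OccursOnly true`: all occurrences of predicate variables in `φ` are positive (below an
even number of negations); `φ.OccursOnly false`: all of them are negative. -/
def OccursOnly : {Γ : List L.Srt} → Bool → Formula L FV PV Γ → Prop
  | _, b, .pvar _ _ => b = true
  | _, _, .atom _ _ => True
  | _, b, .neg φ => φ.OccursOnly (!b)
  | _, b, .or φ ψ => φ.OccursOnly b ∧ ψ.OccursOnly b
  | _, b, .and φ ψ => φ.OccursOnly b ∧ ψ.OccursOnly b
  | _, b, .ex _ φ => φ.OccursOnly b
  | _, b, .all _ φ => φ.OccursOnly b

/-- All predicate variables occur only positively. -/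
def Positive (φ : Formula L FV PV Γ) : Prop := φ.OccursOnly true

/-- Implication is an abbreviation. -/
def imp (φ ψ : Formula L FV PV Γ) : Formula L FV PV Γ := .or (.neg φ) ψ

def castCtx (h : Γ = Δ) (φ : Formula L FV PV Γ) : Formula L FV PV Δ := h ▸ φ

end Formula

/-! ## Semantics of formulas -/

/-- Interpretations of function variables by total functions. -/
abbrev FInterp (M : Struc.{u, v} L) (FV : FunVars L.Srt) :=
  (w : List L.Srt) → (s : L.Srt) → FV w s → Tup M.carrier w → M.carrier s

/-- The lattice of predicates on tuples of sorts `w` (pointwise order). -/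
abbrev Pred (M : Struc.{u, v} L) (w : List L.Srt) := Tup M.carrier w → Prop

/-- Interpretations of predicate variables. -/
abbrev PInterp (M : Struc.{u, v} L) (PV : PredVars L.Srt) :=
  (X : PV.Idx) → Pred M (PV.ar X)

def Term.eval (M : Struc.{u, v} L) (F : FInterp M FV) (e : Tup M.carrier Γ) :
    {s : L.Srt} → Term L FV Γ s → M.carrier s
  | _, .var x => e _ x
  | _, .fvar f args => F _ _ f fun t x => (args t x).eval M F e
  | _, .fn f args => M.fnI f fun t x => (args t x).eval M F e

def Terms.eval (M : Struc.{u, v} L) (F : FInterp M FV) {w : List L.Srt}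
    (ts : Terms L FV w Γ) (e : Tup M.carrier Γ) : Tup M.carrier w :=
  fun t x => (ts t x).eval M F e

def Formula.eval (M : Struc.{u, v} L) (F : FInterp M FV) (ρ : PInterp M PV) :
    {Γ : List L.Srt} → Formula L FV PV Γ → Tup M.carrier Γ → Prop
  | _, .pvar X args, e => ρ X (args.eval M F e)
  | _, .atom p args, e => M.prI p (args.eval M F e)
  | _, .neg φ, e => ¬ φ.eval M F ρ e
  | _, .or φ ψ, e => φ.eval M F ρ e ∨ ψ.eval M F ρ e
  | _, .and φ ψ, e => φ.eval M F ρ e ∧ ψ.eval M F ρ e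
  | _, .ex s φ, e => ∃ a : M.carrier s, φ.eval M F ρ (Tup.cons a e)
  | _, .all s φ, e => ∀ a : M.carrier s, φ.eval M F ρ (Tup.cons a e)

/-! ## Constraint logic programs with least and greatest fixpoints -/

/-- The kind of an equation: least or greatest fixpoint. -/
inductive Kind
  | mu
  | nu
  deriving DecidableEq

/-- The predicate variables available in a program with `m` equations: the defined predicates
`X i` with argument sorts `ar i`, and for each `r` in `W` a binary predicate variable (to be
interpreted by a well-founded relation) on tuples of sorts `W.ar r`. -/
def progVars {S : Type u} {m : ℕ} (ar : Fin m → List S) (W : PredVars S) : PredVars S where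
  Idx := Fin m ⊕ W.Idx
  ar := Sum.elim ar fun r => W.ar r ++ W.ar r

/-- No predicate variables. -/
abbrev noPV (S : Type u) : PredVars S := ⟨Empty, fun x => nomatch x⟩

/-- A program: the sequence of equations `X i (x) =_{kind i} body i`, `i = 0, …, m - 1`, where
`x` ranges over tuples of sorts `ar i`. Apart from the defined predicates, bodies may mention
the function variables `FV` and the binary predicate variables `W`. -/
structure MuCLP (L : Signature.{u}) (FV : FunVars L.Srt) (W : PredVars L.Srt) (m : ℕ) where
  ar : Fin m → List L.Srt
  kind : Fin m → Kind
  body : (i : Fin m) → Formula L FV (progVars ar W) (ar i)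

/-- The formulas that may mention the predicates of the program `P`; the queries for `P` with
free term variables `Γ`. -/
abbrev MuCLP.Query {W : PredVars L.Srt} {m : ℕ} (P : MuCLP L FV W m) (Γ : List L.Srt) :=
  Formula L FV (progVars P.ar W) Γ

/-- Least and greatest fixpoint operators. -/
def FP {M : Struc.{u, v} L} {w : List L.Srt} : Kind → (Pred M w → Pred M w) → Pred M w
  | .mu, F => sInf {q | F q ≤ q}
  | .nu, F => sSup {q | q ≤ F q}

/-- Join an interpretation of the defined predicates and one of the binary variables. -/
def joinInterp {M : Struc.{u, v} L} {W : PredVars L.Srt} {m : ℕ} {ar : Fin m → List L.Srt}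
    (ρ : (i : Fin m) → Pred M (ar i)) (χ : (r : W.Idx) → Pred M (W.ar r ++ W.ar r)) :
    PInterp M (progVars ar W)
  | .inl i => ρ i
  | .inr r => χ r

namespace MuCLP
variable {W : PredVars L.Srt} {m : ℕ}

/-- The interpretation of the last `j` equations, given an interpretation `ρ` of the
predicates defined by the equations before them (the values of `ρ` at the last `j` predicates
are overwritten). With `X k` the first of these `j` equations, `X k` is the fixpoint of the
map that sends `q` to the value of its body when `X k` is `q` and the later predicates are
interpreted accordingly; then the later equations are interpreted. -/
def solve (P : MuCLP L FV W m) (M : Struc.{u, v} L) (F : FInterp M FV)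
    (χ : (r : W.Idx) → Pred M (W.ar r ++ W.ar r)) :
    (j : ℕ) → j ≤ m → ((i : Fin m) → Pred M (P.ar i)) → ((i : Fin m) → Pred M (P.ar i))
  | 0, _, ρ => ρ
  | j + 1, h, ρ =>
    let k : Fin m := ⟨m - (j + 1), by omega⟩
    let rest := P.solve M F χ j (Nat.le_of_succ_le h)
    rest (Function.update ρ k
      (FP (P.kind k) fun q e =>
        (P.body k).eval M F (joinInterp (rest (Function.update ρ k q)) χ) e))

/-- The interpretation of all the predicates defined by a program. -/
def sem (P : MuCLP L FV W m) (M : Struc.{u, v} L) (F : FInterp M FV)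
    (χ : (r : W.Idx) → Pred M (W.ar r ++ W.ar r)) : (i : Fin m) → Pred M (P.ar i) :=
  P.solve M F χ m le_rfl fun _ _ => False

end MuCLP

/-- A closed program (no function variables, no predicate variables besides the defined ones):
the programs of which validity is asked. -/
abbrev ClosedMuCLP (L : Signature.{u}) (m : ℕ) := MuCLP L (noFV L.Srt) (noPV L.Srt) m

/-- Validity `P ⊨ φ`: the query holds under the interpretation given by `P`, for all values of
its free term variables. -/
def ClosedMuCLP.Models {m : ℕ} (P : ClosedMuCLP L m) (M : Struc.{u, v} L) (φ : P.Query Γ) :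
    Prop :=
  ∀ e : Tup M.carrier Γ,
    φ.eval M (fun _ _ f => f.elim)
      (joinInterp (P.sem M (fun _ _ f => f.elim) (fun r => Empty.elim r)) (fun r => Empty.elim r)) e

/-! ## Predicate constraint satisfaction problems -/

/-- Formulas without quantifiers and predicate variables. -/
inductive QF (L : Signature.{u}) (FV : FunVars L.Srt) (Γ : List L.Srt) : Type u
  | bot : QF L FV Γ
  | atom {w} (p : L.Pr w) (args : Terms L FV w Γ) : QF L FV Γ
  | neg (φ : QF L FV Γ) : QF L FV Γ
  | or (φ ψ : QF L FV Γ) : QF L FV Γ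
  | and (φ ψ : QF L FV Γ) : QF L FV Γ

def QF.subst (θ : Terms L FV Γ Δ) : QF L FV Γ → QF L FV Δ
  | .bot => .bot
  | .atom p args => .atom p (args.subst θ)
  | .neg φ => .neg (φ.subst θ)
  | .or φ ψ => .or (φ.subst θ) (ψ.subst θ)
  | .and φ ψ => .and (φ.subst θ) (ψ.subst θ)

def QF.eval (M : Struc.{u, v} L) (F : FInterp M FV) (e : Tup M.carrier Γ) : QF L FV Γ → Prop
  | .bot => False
  | .atom p args => M.prI p (args.eval M F e)
  | .neg φ => ¬ φ.eval M F e
  | .or φ ψ => φ.eval M F e ∨ ψ.eval M F e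
  | .and φ ψ => φ.eval M F e ∧ ψ.eval M F e

/-- A predicate variable applied to terms. -/
structure PAtom (L : Signature.{u}) (FV : FunVars L.Srt) (PV : PredVars L.Srt)
    (Γ : List L.Srt) where
  X : PV.Idx
  args : Terms L FV (PV.ar X) Γ

def PAtom.subst (θ : Terms L FV Γ Δ) (a : PAtom L FV PV Γ) : PAtom L FV PV Δ :=
  ⟨a.X, a.args.subst θ⟩

/-- A clause over the term variables `Γ`: the disjunction of a formula without quantifiers and
predicate variables, finitely many `X i (t i)` and finitely many `¬ X i (t i)`. -/
structure ClauseOver (L : Signature.{u}) (FV : FunVars L.Srt) (PV : PredVars L.Srt)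
    (Γ : List L.Srt) where
  thy : QF L FV Γ
  pos : List (PAtom L FV PV Γ)
  neg : List (PAtom L FV PV Γ)

namespace ClauseOver

def subst (θ : Terms L FV Γ Δ) (c : ClauseOver L FV PV Γ) : ClauseOver L FV PV Δ :=
  ⟨c.thy.subst θ, c.pos.map (PAtom.subst θ), c.neg.map (PAtom.subst θ)⟩

/-- The disjunction of two clauses. -/
def or (c d : ClauseOver L FV PV Γ) : ClauseOver L FV PV Γ :=
  ⟨.or c.thy d.thy, c.pos ++ d.pos, c.neg ++ d.neg⟩

def eval (M : Struc.{u, v} L) (F : FInterp M FV) (ρ : PInterp M PV)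
    (c : ClauseOver L FV PV Γ) (e : Tup M.carrier Γ) : Prop :=
  c.thy.eval M F e ∨ (∃ a ∈ c.pos, ρ a.X (a.args.eval M F e)) ∨
    (∃ a ∈ c.neg, ¬ ρ a.X (a.args.eval M F e))

end ClauseOver

/-- A clause, with its own (implicitly universally quantified) term variables. -/
structure Clause (L : Signature.{u}) (FV : FunVars L.Srt) (PV : PredVars L.Srt) where
  ctx : List L.Srt
  clause : ClauseOver L FV PV ctx

/-- A predicate constraint satisfaction problem with function variables and well-foundedness
constraints: a finite set of clauses and a set of predicate variables that are required to be
well-founded. -/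
structure PCSP (L : Signature.{u}) (FV : FunVars L.Srt) (PV : PredVars L.Srt) where
  clauses : List (Clause L FV PV)
  wf : Set PV.Idx

/-- The interpretation of `X` is a well-founded relation: `X` has argument sorts `w, w` and
there is no infinite sequence of tuples of which consecutive members are related. -/
def IsWF {M : Struc.{u, v} L} (ρ : PInterp M PV) (X : PV.Idx) : Prop :=
  ∃ (w : List L.Srt) (h : PV.ar X = w ++ w),
    ¬ ∃ e : ℕ → Tup M.carrier w, ∀ n, ρ X (Tup.cast h.symm (Tup.append (e n) (e (n + 1))))

/-- Semantic solutions. -/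
def PCSP.IsSolution (C : PCSP L FV PV) (M : Struc.{u, v} L) (F : FInterp M FV)
    (ρ : PInterp M PV) : Prop :=
  (∀ c ∈ C.clauses, ∀ e : Tup M.carrier c.ctx, c.clause.eval M F ρ e) ∧ ∀ X ∈ C.wf, IsWF ρ X

/-! ## Prenex conjunctive normal form -/

/-- Conjunctions of clauses. -/
abbrev CNF (L : Signature.{u}) (FV : FunVars L.Srt) (PV : PredVars L.Srt) (Γ : List L.Srt) :=
  List (ClauseOver L FV PV Γ)

namespace CNF

def and (A B : CNF L FV PV Γ) : CNF L FV PV Γ := A ++ B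

/-- Distribution of disjunction over conjunction. -/
def or (A B : CNF L FV PV Γ) : CNF L FV PV Γ := A.flatMap fun c => B.map fun d => c.or d

def weaken {s : L.Srt} (A : CNF L FV PV Γ) : CNF L FV PV (s :: Γ) :=
  A.map (ClauseOver.subst (Terms.weaken Terms.id))

end CNF

inductive Quant
  | all
  | ex

/-- A block of quantifiers in front of a conjunction of clauses. -/
inductive Prenex (L : Signature.{u}) (FV : FunVars L.Srt) (PV : PredVars L.Srt) :
    List L.Srt → Type u
  | matrix {Γ : List L.Srt} (A : CNF L FV PV Γ) : Prenex L FV PV Γ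
  | quant {Γ : List L.Srt} (Q : Quant) (s : L.Srt) (p : Prenex L FV PV (s :: Γ)) : Prenex L FV PV Γ

namespace Prenex

def substAll : {Γ Δ : List L.Srt} → Prenex L FV PV Γ → Terms L FV Γ Δ → Prenex L FV PV Δ
  | _, _, .matrix A, θ => .matrix (A.map (ClauseOver.subst θ))
  | _, _, .quant Q s p, θ => .quant Q s (p.substAll θ.lift)

def weaken {s : L.Srt} (p : Prenex L FV PV Γ) : Prenex L FV PV (s :: Γ) :=
  p.substAll (Terms.weaken Terms.id)

/-- Combine a matrix and a prenex formula by a connective, pulling out the quantifiers. -/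
def mergeMatrix (op : {Γ : List L.Srt} → CNF L FV PV Γ → CNF L FV PV Γ → CNF L FV PV Γ) :
    {Γ : List L.Srt} → CNF L FV PV Γ → Prenex L FV PV Γ → Prenex L FV PV Γ
  | _, A, .matrix B => .matrix (op A B)
  | _, A, .quant Q s q => .quant Q s (mergeMatrix op A.weaken q)

/-- Combine two prenex formulas by a connective, pulling out the quantifiers. -/
def merge (op : {Γ : List L.Srt} → CNF L FV PV Γ → CNF L FV PV Γ → CNF L FV PV Γ) :
    {Γ : List L.Srt} → Prenex L FV PV Γ → Prenex L FV PV Γ → Prenex L FV PV Γ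
  | _, .matrix A, q => mergeMatrix op A q
  | _, .quant Q s p, q => .quant Q s (merge op p q.weaken)

/-- The clauses of the matrix. -/
def clauses : {Γ : List L.Srt} → Prenex L FV PV Γ → List (Clause L FV PV)
  | _, .matrix A => A.map fun c => ⟨_, c⟩
  | _, .quant _ _ p => p.clauses

end Prenex

/-- Prenex conjunctive normal form of `φ` (for `true`), resp. of `¬ φ` (for `false`). -/
def Formula.prenex : {Γ : List L.Srt} → Bool → Formula L FV PV Γ → Prenex L FV PV Γ
  | _, true, .pvar X args => .matrix [⟨.bot, [⟨X, args⟩], []⟩]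
  | _, false, .pvar X args => .matrix [⟨.bot, [], [⟨X, args⟩]⟩]
  | _, true, .atom p args => .matrix [⟨.atom p args, [], []⟩]
  | _, false, .atom p args => .matrix [⟨.neg (.atom p args), [], []⟩]
  | _, b, .neg φ => φ.prenex (!b)
  | _, true, .or φ ψ => Prenex.merge CNF.or (φ.prenex true) (ψ.prenex true)
  | _, false, .or φ ψ => Prenex.merge CNF.and (φ.prenex false) (ψ.prenex false)
  | _, true, .and φ ψ => Prenex.merge CNF.and (φ.prenex true) (ψ.prenex true)
  | _, false, .and φ ψ => Prenex.merge CNF.or (φ.prenex false) (ψ.prenex false)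
  | _, true, .ex s φ => .quant .ex s (φ.prenex true)
  | _, false, .ex s φ => .quant .all s (φ.prenex false)
  | _, true, .all s φ => .quant .all s (φ.prenex true)
  | _, false, .all s φ => .quant .ex s (φ.prenex false)

/-- The set of clauses `C` of the prenex conjunctive normal form `∀ x. ⋀ C` of `φ`. In the
reduction this is applied to formulas whose existential quantifiers have been Skolemized, so
the prefix contains universal quantifiers only. -/
def Formula.cnf (φ : Formula L FV PV Γ) : List (Clause L FV PV) := (φ.prenex true).clauses

/-! ## The theory extended by Booleans and dummy constants -/

inductive BoolFn (L : Signature.{u}) : List (Option L.Srt) → Option L.Srt → Type u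
  | base {w s} (f : L.Fn w s) : BoolFn L (w.map some) (some s)
  | tt : BoolFn L [] none
  | ff : BoolFn L [] none
  | dummy (s : L.Srt) : BoolFn L [] (some s)

inductive BoolPr (L : Signature.{u}) : List (Option L.Srt) → Type u
  | base {w} (p : L.Pr w) : BoolPr L (w.map some)
  | isTrue : BoolPr L [none]

/-- The signature extended by a sort `none` of Booleans, constants `tt` and `ff` and a predicate
`isTrue` for it, and a dummy constant of each sort of `L`. -/
def Signature.withBool (L : Signature.{u}) : Signature.{u} where
  Srt := Option L.Srt
  Fn := BoolFn L
  Pr := BoolPr L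

/-- The carriers of the extended structure. -/
def BoolCarrier (D : L.Srt → Type v) : Option L.Srt → Type v
  | none => ULift Bool
  | some s => D s

/-- The interpretation of the function symbols of the extended signature. -/
def Struc.boolFnI (M : Struc.{u, v} L) (d : (s : L.Srt) → M.carrier s) :
    {w : List (Option L.Srt)} → {s : Option L.Srt} → BoolFn L w s →
      Tup (BoolCarrier M.carrier) w → BoolCarrier M.carrier s
  | _, _, .base f, e => M.fnI f (Tup.unmapSome (D := BoolCarrier M.carrier) e)
  | _, _, .tt, _ => ULift.up true
  | _, _, .ff, _ => ULift.up false
  | _, _, .dummy s, _ => d s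

/-- The interpretation of the predicate symbols of the extended signature. -/
def Struc.boolPrI (M : Struc.{u, v} L) : {w : List (Option L.Srt)} → BoolPr L w →
      Tup (BoolCarrier M.carrier) w → Prop
  | _, .base p, e => M.prI p (Tup.unmapSome (D := BoolCarrier M.carrier) e)
  | _, .isTrue, e => ULift.down (e none .zero) = true

/-- The standard extension of a structure by the Booleans, the dummy constants being
interpreted by the values `d`. -/
def Struc.withBool (M : Struc.{u, v} L) (d : (s : L.Srt) → M.carrier s) :
    Struc.{u, v} L.withBool where
  carrier := BoolCarrier M.carrier
  nonempty
    | none => ⟨ULift.up true⟩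
    | some s => M.nonempty s
  fnI f e := M.boolFnI d f e
  prI p e := M.boolPrI p e

/-- The Boolean constants and the dummy constants as terms. -/
def ttTerm {FV : FunVars L.withBool.Srt} {Γ : List L.withBool.Srt} :
    Term L.withBool FV Γ none := .fn BoolFn.tt Tup.nil
def ffTerm {FV : FunVars L.withBool.Srt} {Γ : List L.withBool.Srt} :
    Term L.withBool FV Γ none := .fn BoolFn.ff Tup.nil

/-- Dummy terms of the sorts `w`. -/
def dummies {FV : FunVars L.withBool.Srt} {Γ : List L.withBool.Srt}
    (w : List L.withBool.Srt) : Terms L.withBool FV w Γ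
  | none, _ => ffTerm
  | some s, _ => .fn (BoolFn.dummy s) Tup.nil

/-- A Boolean term used as a formula. -/
def boolFml {FV : FunVars L.withBool.Srt} {PV : PredVars L.withBool.Srt}
    {Γ : List L.withBool.Srt} (b : Term L.withBool FV Γ none) : Formula L.withBool FV PV Γ :=
  .atom BoolPr.isTrue (Tup.cons b Tup.nil)

/-- A variable of a context, in the image of the context in the extended sorts. -/
def Var.toBool {t : L.Srt} : {Γ : List L.Srt} → Var Γ t → Var (Γ.map some) (some t)
  | _ :: _, .zero => .zero
  | _ :: _, .succ x => .succ x.toBool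

/-- The inclusion of the language of `L` into the extended language. -/
def Term.toBool {Γ : List L.Srt} : {s : L.Srt} → Term L (noFV L.Srt) Γ s →
    Term L.withBool (noFV L.withBool.Srt) (Γ.map some) (some s)
  | _, .var x => .var x.toBool
  | _, .fvar F _ => nomatch F
  | _, .fn f args => .fn (BoolFn.base f)
      (Tup.mapSome (D := Term L.withBool (noFV L.withBool.Srt) (Γ.map some))
        fun t x => (args t x).toBool)

def Terms.toBool {w Γ : List L.Srt} (ts : Terms L (noFV L.Srt) w Γ) :
    Terms L.withBool (noFV L.withBool.Srt) (w.map some) (Γ.map some) :=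
  Tup.mapSome (D := Term L.withBool (noFV L.withBool.Srt) (Γ.map some))
    fun t x => (ts t x).toBool

def Formula.toBool {m : ℕ} {ar : Fin m → List L.Srt} : {Γ : List L.Srt} →
    Formula L (noFV L.Srt) (progVars ar (noPV L.Srt)) Γ →
    Formula L.withBool (noFV L.withBool.Srt)
      (progVars (S := L.withBool.Srt) (fun i => (ar i).map some) (noPV L.withBool.Srt))
      (Γ.map some)
  | _, .pvar (.inl i) args => .pvar (.inl i) (Terms.toBool args)
  | _, .pvar (.inr r) _ => nomatch r
  | _, .atom p args => .atom (BoolPr.base p) args.toBool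
  | _, .neg φ => .neg φ.toBool
  | _, .or φ ψ => .or φ.toBool ψ.toBool
  | _, .and φ ψ => .and φ.toBool ψ.toBool
  | _, .ex s φ => .ex (some s) φ.toBool
  | _, .all s φ => .all (some s) φ.toBool

def ClosedMuCLP.toBool {m : ℕ} (P : ClosedMuCLP L m) : ClosedMuCLP L.withBool m where
  ar i := (P.ar i).map some
  kind := P.kind
  body i := (P.body i).toBool

/-! ## First step: Skolemization -/

/-- Names of the Skolem function variables of sort `w → s`: the formula in which the
quantifier occurs (`none` for the query, `some i` for the body of the `i`-th equation) and the
path to its occurrence in this formula. -/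
structure SkolemVar (S : Type u) (m : ℕ) (w : List S) (s : S) : Type u where
  origin : Option (Fin m)
  path : List Bool

/-- Skolemization of the positive existential and the negative universal quantifiers of `φ`,
if `φ` occurs at polarity `b` and at `path` in the formula `o`. The substitution `θ` maps the
variables in scope in the original formula to terms over those that are still in scope after
Skolemization; a Skolem function takes all of the latter as arguments. -/
def Formula.skolem {m : ℕ} (o : Option (Fin m)) : {Γ Δ : List L.Srt} → (b : Bool) →
    (path : List Bool) → Formula L (noFV L.Srt) PV Γ →
    (θ : Terms L (SkolemVar L.Srt m) Γ Δ) → Formula L (SkolemVar L.Srt m) PV Δ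
  | _, _, _, _, .pvar X args, θ => .pvar X (args.ofClosed.subst θ)
  | _, _, _, _, .atom p args, θ => .atom p (args.ofClosed.subst θ)
  | _, _, b, l, .neg φ, θ => .neg (φ.skolem o (!b) (false :: l) θ)
  | _, _, b, l, .or φ ψ, θ => .or (φ.skolem o b (false :: l) θ) (ψ.skolem o b (true :: l) θ)
  | _, _, b, l, .and φ ψ, θ => .and (φ.skolem o b (false :: l) θ) (ψ.skolem o b (true :: l) θ)
  | _, Δ, true, l, .ex s φ, θ =>
      φ.skolem o true (false :: l)
        (Tup.cons (.fvar (w := Δ) (s := s) ⟨o, l⟩ Terms.id) θ)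
  | _, _, false, l, .ex s φ, θ => .ex s (φ.skolem o false (false :: l) θ.lift)
  | _, _, true, l, .all s φ, θ => .all s (φ.skolem o true (false :: l) θ.lift)
  | _, Δ, false, l, .all s φ, θ =>
      φ.skolem o false (false :: l)
        (Tup.cons (.fvar (w := Δ) (s := s) ⟨o, l⟩ Terms.id) θ)

def elimExQuery {m : ℕ} {P : ClosedMuCLP L m} (φ : P.Query Γ) :
    Formula L (SkolemVar L.Srt m) (progVars P.ar (noPV L.Srt)) Γ :=
  φ.skolem none true [] Terms.id

def elimExProg {m : ℕ} (P : ClosedMuCLP L m) : MuCLP L (SkolemVar L.Srt m) (noPV L.Srt) m where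
  ar := P.ar
  kind := P.kind
  body i := (P.body i).skolem (some i) true [] Terms.id

/-! ## Second step: from least to greatest fixpoints -/

section ElimMu
variable {FV : FunVars L.withBool.Srt} {W : PredVars L.withBool.Srt} {m : ℕ}

/-- The sorts `w`, extended in front by the sort of Booleans. -/
abbrev boolCtx (w : List L.withBool.Srt) : List L.withBool.Srt := List.cons (none : Option L.Srt) w

/-- Argument sorts `u`, extended (if `c`) in front by a Boolean and the sorts `w`. -/
def extAr (c : Bool) (w u : List L.withBool.Srt) : List L.withBool.Srt :=
  match c with
  | true => boolCtx (w ++ u)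
  | false => u

/-- Arguments `y`, extended (if `c`) in front by `b` and `x`. -/
def extArgs (c : Bool) {w u Γ : List L.withBool.Srt} (b : Term L.withBool FV Γ none)
    (x : Terms L.withBool FV w Γ) (y : Terms L.withBool FV u Γ) :
    Terms L.withBool FV (extAr c w u) Γ :=
  match c with
  | true => Tup.cons b (Tup.append x y)
  | false => y

/-- The argument sorts after the step for `X k`: the predicates after `X k` get additional
arguments. -/
def stepAr (ar : Fin m → List L.withBool.Srt) (k i : Fin m) : List L.withBool.Srt :=
  extAr (decide (k < i)) (ar k) (ar i)

/-- Add a fresh variable for a binary relation on tuples of sorts `w`. -/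
def PredVars.add {S : Type u} (W : PredVars S) (w : List S) : PredVars S where
  Idx := Option W.Idx
  ar r := r.elim w W.ar

/-- The predicate variables after the step for `X k`. -/
abbrev stepVars (ar : Fin m → List L.withBool.Srt) (W : PredVars L.withBool.Srt) (k : Fin m) :
    PredVars L.withBool.Srt :=
  progVars (stepAr ar k) (W.add (ar k))

/-- The atom `R (x, y)` for the fresh well-founded variable `R` of the step for `X k`. -/
def wfAtom {ar : Fin m → List L.withBool.Srt} (k : Fin m) {Γ : List L.withBool.Srt}
    (x y : Terms L.withBool FV (ar k) Γ) : Formula L.withBool FV (stepVars ar W k) Γ :=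
  .pvar (PV := stepVars ar W k) (.inr none) (Tup.append x y)

/-- The substitution that replaces each `X j` with `k < j` by `λ y. X j (b, x, y)`, and `X k` by
`λ y. X k (y) ∧ guard` if there is a guard. The terms `b`, `x` mention parameters `Θ`. All other
predicates are left alone. -/
def callSubst {ar : Fin m → List L.withBool.Srt} (k : Fin m) {Θ : List L.withBool.Srt}
    (b : Term L.withBool FV Θ none) (x : Terms L.withBool FV (ar k) Θ)
    (guard : Option (Formula L.withBool FV (stepVars ar W k) (ar k ++ Θ))) :
    (X : (progVars ar W).Idx) →
      Formula L.withBool FV (stepVars ar W k) ((progVars ar W).ar X ++ Θ)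
  | .inl j =>
      let call : Formula L.withBool FV (stepVars ar W k) (ar j ++ Θ) :=
        .pvar (PV := stepVars ar W k) (.inl j)
          (extArgs (decide (k < j)) (b.subst Terms.inr) (x.subst Terms.inr) Terms.inl)
      match guard with
      | none => call
      | some g => if h : k = j then .and call (g.castCtx (by rw [h]; rfl)) else call
  | .inr r => .pvar (PV := stepVars ar W k) (.inr (some r)) Terms.inl

/-- `σ₀`: for the query and the equations before `X k`. It replaces `X j`, `k < j`, by
`λ y. X j (⊥, dummies, y)`. -/
def sigmaZero {ar : Fin m → List L.withBool.Srt} (k : Fin m) (X : (progVars ar W).Idx) :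
    Formula L.withBool FV (stepVars ar W k) ((progVars ar W).ar X ++ []) :=
  callSubst k (Θ := []) ffTerm (dummies _) none X

/-- `σ_X`: for the equation of `X k`, with formal arguments `x`. It replaces `X k` by
`λ y. X k (y) ∧ R (x, y)` and `X j`, `k < j`, by `λ y. X j (⊤, x, y)`. -/
def sigmaMu {ar : Fin m → List L.withBool.Srt} (k : Fin m) (X : (progVars ar W).Idx) :
    Formula L.withBool FV (stepVars ar W k) ((progVars ar W).ar X ++ ar k) :=
  callSubst k (Θ := ar k) ttTerm Terms.id (some (wfAtom k Terms.inr Terms.inl)) X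

/-- `σ_i`: for the equations after `X k`, with additional formal arguments `b, x`. It replaces
`X k` by `λ y. X k (y) ∧ (b → R (x, y))` and `X j`, `k < j`, by `λ y. X j (b, x, y)`. -/
def sigmaNu {ar : Fin m → List L.withBool.Srt} (k : Fin m) (X : (progVars ar W).Idx) :
    Formula L.withBool FV (stepVars ar W k) ((progVars ar W).ar X ++ boolCtx (ar k)) :=
  callSubst k (Θ := boolCtx (ar k)) (.var .zero) (fun _ z => .var z.succ)
    (some (.imp (boolFml (.var (.inr (ar k) .zero)))
      (wfAtom k (fun _ z => .var (.inr (ar k) z.succ)) Terms.inl))) X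

/-- The new body of the `i`-th equation. -/
def stepBody {ar : Fin m → List L.withBool.Srt} (k i : Fin m)
    (φ : Formula L.withBool FV (progVars ar W) (ar i)) :
    Formula L.withBool FV (stepVars ar W k) (stepAr ar k i) :=
  match (motive := (c : Bool) →
      Formula L.withBool FV (stepVars ar W k) (extAr c (ar k) (ar i))) decide (k < i) with
  | true => φ.psubst (sigmaNu k) (fun _ z => .var (.succ (.inr (ar k) z)))
      (Tup.cons (.var .zero) fun _ z => .var (.succ z.inl))
  | false =>
      if h : k = i then
        φ.psubst (sigmaMu k) Terms.id (fun _ z => .var (z.cast (congrArg ar h)))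
      else φ.psubst (sigmaZero k) Terms.id Tup.nil

/-- A program with a query. -/
structure Problem (L : Signature.{u}) (FV : FunVars L.Srt) (W : PredVars L.Srt) (m : ℕ)
    (Γ : List L.Srt) where
  prog : MuCLP L FV W m
  query : prog.Query Γ

/-- The step that turns the least fixpoint equation of `X k`, all later equations being greatest
fixpoint equations, into a guarded greatest fixpoint equation. -/
def elimMuStep {Γ : List L.withBool.Srt} (k : Fin m) (A : Problem L.withBool FV W m Γ) :
    Problem L.withBool FV (W.add (A.prog.ar k)) m Γ where
  prog :=
    { ar := stepAr A.prog.ar k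
      kind := Function.update A.prog.kind k .nu
      body := fun i => stepBody k i (A.prog.body i) }
  query := Formula.psubst (sigmaZero k) A.query Terms.id Tup.nil

/-- Process the least fixpoint equations among the first `n` ones, from right to left (all the
later equations are greatest fixpoint equations at this point). The well-founded predicate
variables that are introduced are accumulated in `W`. -/
def elimMuFrom {Γ : List L.withBool.Srt} : (n : ℕ) → n ≤ m → (W : PredVars L.withBool.Srt) →
    Problem L.withBool FV W m Γ → (W' : PredVars L.withBool.Srt) × Problem L.withBool FV W' m Γ
  | 0, _, W, A => ⟨W, A⟩
  | n + 1, h, W, A =>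
    if A.prog.kind ⟨n, h⟩ = .mu then
      elimMuFrom n (Nat.le_of_succ_le h) _ (elimMuStep ⟨n, h⟩ A)
    else elimMuFrom n (Nat.le_of_succ_le h) W A

def elimMu {Γ : List L.withBool.Srt} (A : Problem L.withBool FV W m Γ) :
    (W' : PredVars L.withBool.Srt) × Problem L.withBool FV W' m Γ :=
  elimMuFrom m le_rfl W A

end ElimMu

/-! ## Third step: from greatest fixpoints to predicate variables -/

/-- The clauses of the query and, for each equation `X i (x) = body i`, the clauses of
`X i (x) → body i`, where the `X i` are now uninterpreted predicate variables. -/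
def elimNu {W : PredVars L.Srt} {m : ℕ} (A : Problem L FV W m Γ) :
    List (Clause L FV (progVars A.prog.ar W)) :=
  A.query.cnf ++ (List.finRange m).flatMap fun i =>
    Formula.cnf (.imp (.pvar (PV := progVars A.prog.ar W) (.inl i) Terms.id) (A.prog.body i))

/-! ## The reduction -/

/-- The result of the first two steps, with the well-founded predicate variables. -/
def nuProblem {m : ℕ} (P : ClosedMuCLP L m) (φ : P.Query Γ) :
    (W : PredVars L.withBool.Srt) ×
      Problem L.withBool (SkolemVar L.withBool.Srt m) W m (Γ.map some) :=
  elimMu ⟨elimExProg P.toBool, elimExQuery (P := P.toBool) φ.toBool⟩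

/-- The predicate variables of the constraint satisfaction problem obtained by the reduction. -/
abbrev reductVars {m : ℕ} (P : ClosedMuCLP L m) (φ : P.Query Γ) : PredVars L.withBool.Srt :=
  progVars (nuProblem P φ).2.prog.ar (nuProblem P φ).1

/-- The reduction: Skolemize, replace least by guarded greatest fixpoints, and replace greatest
fixpoints by uninterpreted predicate variables. -/
def reduct {m : ℕ} (P : ClosedMuCLP L m) (φ : P.Query Γ) :
    PCSP L.withBool (SkolemVar L.withBool.Srt m) (reductVars P φ) where
  clauses := elimNu (nuProblem P φ).2
  wf := Set.range Sum.inr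

end MuVal

/-!
The reduction is correct because truth in a nested fixpoint is witnessed by a descending signature,
and the well-founded variables `R` of the reduction are exactly what is needed to state this.

*From a solution to validity.* Greatest fixpoints are handled by the implications `X(x) → body`:
predicates satisfying them are below the interpretation of the program
(`MuCLP.le_solve_of_nu`). It remains to undo the elimination of one least fixpoint `X k`
(`pull_solve_elimMuStep_le`). In the new program, a call from the body of `X k` at the argument `x`
is made in the context `⊤, x`, and the guard, inherited through the later predicates, only admits
calls of `X k` at arguments `y` with `R(x, y)`. Hence, by induction along `R`, every argument in the
new greatest fixpoint belongs to the old least fixpoint. The three substitutions of the step are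
instances of a single operation on interpretations, `pull`. Skolem functions yield witnesses for
the original quantifiers by monotonicity (`Formula.polImp_skolem`).

*From validity to a solution.* Skolem functions and the relations `R` do not see the
contexts in which a predicate is called, so one positional choice has to serve all contexts. It is
obtained from signatures: `MuCLP.exists_signature` assigns to each true atom a family of ordinals,
indexed by the equations, such that the body of its equation is already true when it may only use
atoms whose signature is lexicographically no larger, and strictly smaller where a least fixpoint
is unfolded, up to the component that matters (`Descends`). Skolem functions are chosen
relative to these restricted interpretations (`exists_skolem_functions`), and `R` for `X k`
compares signatures up to the component `k`, which is well-founded. The predicate `X i` in a context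
`⊤, x` belonging to `X k` is interpreted by the true atoms whose signature is below that of
`X k (x)`; this invariant is preserved by every step (`Certified.step`).

Finally the clauses express the truth of query and implications because a Skolemized formula has
a universal prenex normal form (`Formula.forall_cnf_iff`), and the passage to the theory with
Booleans does not change validity (`ClosedMuCLP.models_toBool`).
-/

universe w

namespace MuVal

/-! ### Tuples, substitution and evaluation -/

section Evaluation

namespace Tup

variable {S : Type u} {D : S → Type v} {Γ Δ : List S}

/-- The left part of a tuple over `Γ ++ Δ`. -/
def left (e : Tup D (Γ ++ Δ)) : Tup D Γ := fun t x => e t x.inl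

/-- The right part of a tuple over `Γ ++ Δ`. -/
def right (e : Tup D (Γ ++ Δ)) : Tup D Δ := fun t x => e t (x.inr Γ)

theorem cons_zero_tail {s : S} (e : Tup D (s :: Γ)) : cons (e _ .zero) e.tail = e := by
  funext t x
  cases x <;> rfl

theorem eq_nil (e : Tup D []) : e = nil := by
  funext t x
  cases x

theorem left_append : ∀ {Γ : List S} (d : Tup D Γ) (e : Tup D Δ), (append d e).left = d
  | [], d, _ => (eq_nil _).trans (eq_nil d).symm
  | _ :: _, d, e => by
    funext t x
    cases x with
    | zero => rfl
    | succ x => exact congrFun (congrFun (left_append d.tail e) t) x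

theorem right_append : ∀ {Γ : List S} (d : Tup D Γ) (e : Tup D Δ), (append d e).right = e
  | [], _, _ => rfl
  | _ :: _, d, e => right_append d.tail e

theorem append_left_right : ∀ {Γ : List S} (e : Tup D (Γ ++ Δ)), append e.left e.right = e
  | [], _ => rfl
  | s :: Γ, e => by
    funext t x
    cases x with
    | zero => rfl
    | succ x => exact congrFun (congrFun (append_left_right (Γ := Γ) (tail (Γ := Γ ++ Δ) e)) t) x

theorem unmapSome_mapSome {D : Option S → Type v} :
    ∀ {Γ : List S} (e : Tup (fun t => D (some t)) Γ), unmapSome (mapSome e) = e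
  | [], _ => (eq_nil _).trans (eq_nil _).symm
  | _ :: _, e => by
    funext t x
    cases x with
    | zero => rfl
    | succ x => exact congrFun (congrFun (unmapSome_mapSome e.tail) t) x

theorem mapSome_unmapSome {D : Option S → Type v} :
    ∀ {Γ : List S} (e : Tup D (Γ.map some)), mapSome (unmapSome e) = e
  | [], _ => (eq_nil _).trans (eq_nil _).symm
  | s :: Γ, e => by
    funext t x
    cases x with
    | zero => rfl
    | succ x =>
      exact congrFun (congrFun (mapSome_unmapSome (Γ := Γ) (tail (Γ := Γ.map some) e)) t) x

end Tup

variable {L : Signature.{u}} {FV : FunVars L.Srt} {PV PV' : PredVars L.Srt}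
  {Γ Δ Θ : List L.Srt} {M : Struc.{u, v} L} {F : FInterp M FV}

theorem Term.eval_subst (θ : Terms L FV Γ Δ) (e : Tup M.carrier Δ) {s : L.Srt}
    (t : Term L FV Γ s) : (t.subst θ).eval M F e = t.eval M F (θ.eval M F e) := by
  induction t with
  | var x => rfl
  | fvar f args ih | fn f args ih =>
    simp only [Term.subst, Term.eval]
    congr 1
    funext t x
    exact ih t x

theorem Term.eval_ofClosed (F₀ : FInterp M (noFV L.Srt)) (e : Tup M.carrier Γ) {s : L.Srt}
    (t : Term L (noFV L.Srt) Γ s) : (t.ofClosed (FV := FV)).eval M F e = t.eval M F₀ e := by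
  induction t with
  | var x => rfl
  | fvar f args ih => exact f.elim
  | fn f args ih =>
    simp only [Term.ofClosed, Term.eval]
    congr 1
    funext t x
    exact ih t x

namespace Terms

theorem eval_subst {w : List L.Srt} (ts : Terms L FV w Γ) (θ : Terms L FV Γ Δ)
    (e : Tup M.carrier Δ) : (ts.subst θ).eval M F e = ts.eval M F (θ.eval M F e) := by
  funext t x
  exact Term.eval_subst θ e _

theorem eval_ofClosed (F₀ : FInterp M (noFV L.Srt)) {w : List L.Srt}
    (ts : Terms L (noFV L.Srt) w Γ) (e : Tup M.carrier Γ) :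
    (ts.ofClosed (FV := FV)).eval M F e = ts.eval M F₀ e := by
  funext t x
  exact Term.eval_ofClosed F₀ e _

theorem eval_id (e : Tup M.carrier Γ) : (Terms.id : Terms L FV Γ Γ).eval M F e = e := rfl

theorem eval_weaken {w : List L.Srt} {s : L.Srt} (ts : Terms L FV w Γ) (a : M.carrier s)
    (e : Tup M.carrier Γ) : ts.weaken.eval M F (Tup.cons a e) = ts.eval M F e :=
  eval_subst _ _ _

theorem eval_cons {w : List L.Srt} {s : L.Srt} (t : Term L FV Γ s) (ts : Terms L FV w Γ)
    (e : Tup M.carrier Γ) :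
    Terms.eval M F (Tup.cons t ts) e = Tup.cons (t.eval M F e) (ts.eval M F e) := by
  funext t x
  cases x <;> rfl

theorem eval_lift {s : L.Srt} (θ : Terms L FV Γ Δ) (a : M.carrier s) (e : Tup M.carrier Δ) :
    θ.lift.eval M F (Tup.cons a e) = Tup.cons a (θ.eval M F e) := by
  rw [Terms.lift, eval_cons, eval_weaken]
  rfl

theorem eval_append : ∀ {w w' : List L.Srt} (ts : Terms L FV w Γ) (ts' : Terms L FV w' Γ)
    (e : Tup M.carrier Γ),
    Terms.eval M F (Tup.append ts ts') e = Tup.append (ts.eval M F e) (ts'.eval M F e)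
  | [], _, _, _, _ => rfl
  | _ :: _, _, ts, ts', e => by
    simp only [Tup.append]
    exact (eval_cons _ _ _).trans (congrArg _ (eval_append ts.tail ts' e))

end Terms

namespace Formula

theorem eval_subst {ρ : PInterp M PV} : ∀ {Γ Δ : List L.Srt} (φ : Formula L FV PV Γ)
    (θ : Terms L FV Γ Δ) (e : Tup M.carrier Δ),
    (φ.subst θ).eval M F ρ e ↔ φ.eval M F ρ (θ.eval M F e)
  | _, _, .pvar X args, θ, e => by simp only [subst, eval, Terms.eval_subst]
  | _, _, .atom p args, θ, e => by simp only [subst, eval, Terms.eval_subst]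
  | _, _, .neg φ, θ, e => not_congr (eval_subst φ θ e)
  | _, _, .or φ ψ, θ, e => or_congr (eval_subst φ θ e) (eval_subst ψ θ e)
  | _, _, .and φ ψ, θ, e => and_congr (eval_subst φ θ e) (eval_subst ψ θ e)
  | _, _, .ex s φ, θ, e => exists_congr fun a => by
      rw [eval_subst φ θ.lift, Terms.eval_lift]
  | _, _, .all s φ, θ, e => forall_congr' fun a => by
      rw [eval_subst φ θ.lift, Terms.eval_lift]

/-- Substituting predicates amounts to evaluating under the interpretation that the substituted
predicates denote, the parameters having the values of `π`. -/
theorem eval_psubst {ρ : PInterp M PV'}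
    (σ : (X : PV.Idx) → Formula L FV PV' (PV.ar X ++ Θ)) :
    ∀ {Γ Δ : List L.Srt} (φ : Formula L FV PV Γ) (θ : Terms L FV Γ Δ) (π : Terms L FV Θ Δ)
    (e : Tup M.carrier Δ),
    (φ.psubst σ θ π).eval M F ρ e ↔
      φ.eval M F (fun X y => (σ X).eval M F ρ (Tup.append y (π.eval M F e))) (θ.eval M F e)
  | _, _, .pvar X args, θ, π, e => by
      simp only [psubst, eval, eval_subst, Terms.eval_append, Terms.eval_subst]
  | _, _, .atom p args, θ, π, e => by simp only [psubst, eval, Terms.eval_subst]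
  | _, _, .neg φ, θ, π, e => not_congr (eval_psubst σ φ θ π e)
  | _, _, .or φ ψ, θ, π, e => or_congr (eval_psubst σ φ θ π e) (eval_psubst σ ψ θ π e)
  | _, _, .and φ ψ, θ, π, e => and_congr (eval_psubst σ φ θ π e) (eval_psubst σ ψ θ π e)
  | _, _, .ex s φ, θ, π, e => exists_congr fun a => by
      rw [eval_psubst σ φ θ.lift, Terms.eval_lift, Terms.eval_weaken]
  | _, _, .all s φ, θ, π, e => forall_congr' fun a => by
      rw [eval_psubst σ φ θ.lift, Terms.eval_lift, Terms.eval_weaken]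

theorem eval_imp {ρ : PInterp M PV} (φ ψ : Formula L FV PV Γ) (e : Tup M.carrier Γ) :
    (φ.imp ψ).eval M F ρ e ↔ (φ.eval M F ρ e → ψ.eval M F ρ e) :=
  imp_iff_not_or.symm

theorem eval_of_occursOnly {ρ ρ' : PInterp M PV} (h : ρ ≤ ρ') :
    ∀ {Γ : List L.Srt} (b : Bool) (φ : Formula L FV PV Γ), φ.OccursOnly b → ∀ e,
      φ.eval M F (if b then ρ else ρ') e → φ.eval M F (if b then ρ' else ρ) e
  | _, b, .pvar X args, hb, e, he => by
      obtain rfl : b = true := hb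
      exact h X _ he
  | _, b, .atom p args, _, e, he => he
  | _, b, .neg φ, hb, e, he => fun hc => he (by
      have := eval_of_occursOnly h (!b) φ hb e
      cases b <;> exact this hc)
  | _, b, .or φ ψ, hb, e, he =>
      he.imp (eval_of_occursOnly h b φ hb.1 e) (eval_of_occursOnly h b ψ hb.2 e)
  | _, b, .and φ ψ, hb, e, he =>
      he.imp (eval_of_occursOnly h b φ hb.1 e) (eval_of_occursOnly h b ψ hb.2 e)
  | _, b, .ex s φ, hb, e, he => he.imp fun a => eval_of_occursOnly h b φ hb _
  | _, b, .all s φ, hb, e, he => fun a => eval_of_occursOnly h b φ hb _ (he a)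

theorem Positive.eval_mono {φ : Formula L FV PV Γ} (hφ : φ.Positive) {ρ ρ' : PInterp M PV}
    (h : ρ ≤ ρ') {e : Tup M.carrier Γ} : φ.eval M F ρ e → φ.eval M F ρ' e :=
  eval_of_occursOnly h true φ hφ e

end Formula

end Evaluation

/-! ### Prenex conjunctive normal forms -/

section Prenex

variable {L : Signature.{u}} {FV : FunVars L.Srt} {PV PV' : PredVars L.Srt}
  {Γ Δ Θ : List L.Srt} {M : Struc.{u, v} L} {F : FInterp M FV} {ρ : PInterp M PV}

theorem QF.eval_subst (θ : Terms L FV Γ Δ) (e : Tup M.carrier Δ) : ∀ φ : QF L FV Γ,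
    (φ.subst θ).eval M F e ↔ φ.eval M F (θ.eval M F e)
  | .bot => Iff.rfl
  | .atom p args => by simp only [QF.subst, QF.eval, Terms.eval_subst]
  | .neg φ => not_congr (QF.eval_subst θ e φ)
  | .or φ ψ => or_congr (QF.eval_subst θ e φ) (QF.eval_subst θ e ψ)
  | .and φ ψ => and_congr (QF.eval_subst θ e φ) (QF.eval_subst θ e ψ)

theorem ClauseOver.eval_subst (θ : Terms L FV Γ Δ) (e : Tup M.carrier Δ)
    (c : ClauseOver L FV PV Γ) :
    (c.subst θ).eval M F ρ e ↔ c.eval M F ρ (θ.eval M F e) := by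
  simp only [ClauseOver.eval, ClauseOver.subst, QF.eval_subst, List.mem_map,
    exists_exists_and_eq_and, PAtom.subst, Terms.eval_subst]

theorem ClauseOver.eval_or (c c' : ClauseOver L FV PV Γ) (e : Tup M.carrier Γ) :
    (c.or c').eval M F ρ e ↔ c.eval M F ρ e ∨ c'.eval M F ρ e := by
  simp only [ClauseOver.eval, ClauseOver.or, QF.eval, List.mem_append, or_and_right, exists_or]
  exact iff_of_eq (by ac_rfl)

/-- The truth value of a conjunction of clauses. -/
def CNF.eval (M : Struc.{u, v} L) (F : FInterp M FV) (ρ : PInterp M PV) (A : CNF L FV PV Γ)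
    (e : Tup M.carrier Γ) : Prop :=
  ∀ c ∈ A, c.eval M F ρ e

theorem CNF.eval_and (A B : CNF L FV PV Γ) (e : Tup M.carrier Γ) :
    (A.and B).eval M F ρ e ↔ A.eval M F ρ e ∧ B.eval M F ρ e := by
  simp only [CNF.eval, CNF.and, List.mem_append, or_imp, forall_and]

theorem CNF.eval_or (A B : CNF L FV PV Γ) (e : Tup M.carrier Γ) :
    (A.or B).eval M F ρ e ↔ A.eval M F ρ e ∨ B.eval M F ρ e := by
  simp only [CNF.eval, CNF.or, List.mem_flatMap, List.mem_map]
  constructor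
  · intro h
    by_contra! hAB
    obtain ⟨⟨c, hc, hc'⟩, c', hd, hd'⟩ := hAB
    exact ((ClauseOver.eval_or c c' e).1 (h _ ⟨c, hc, c', hd, rfl⟩)).elim hc' hd'
  · rintro h _ ⟨c, hc, c', hd, rfl⟩
    exact (ClauseOver.eval_or c c' e).2 (h.imp (fun h => h c hc) fun h => h c' hd)

theorem CNF.eval_map_subst (θ : Terms L FV Γ Δ) (A : CNF L FV PV Γ) (e : Tup M.carrier Δ) :
    CNF.eval M F ρ (A.map (ClauseOver.subst θ)) e ↔ A.eval M F ρ (θ.eval M F e) := by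
  simp only [CNF.eval, List.mem_map, forall_exists_index, and_imp, forall_apply_eq_imp_iff₂,
    ClauseOver.eval_subst]

theorem CNF.eval_weaken {s : L.Srt} (A : CNF L FV PV Γ) (a : M.carrier s) (e : Tup M.carrier Γ) :
    A.weaken.eval M F ρ (Tup.cons a e) ↔ A.eval M F ρ e := by
  rw [CNF.weaken, CNF.eval_map_subst, Terms.eval_weaken, Terms.eval_id]

namespace Prenex

/-- The truth value of a prenex formula. -/
def eval (M : Struc.{u, v} L) (F : FInterp M FV) (ρ : PInterp M PV) :
    {Γ : List L.Srt} → Prenex L FV PV Γ → Tup M.carrier Γ → Prop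
  | _, .matrix A, e => A.eval M F ρ e
  | _, .quant .all s p, e => ∀ a : M.carrier s, p.eval M F ρ (Tup.cons a e)
  | _, .quant .ex s p, e => ∃ a : M.carrier s, p.eval M F ρ (Tup.cons a e)

theorem eval_substAll : ∀ {Γ Δ : List L.Srt} (p : Prenex L FV PV Γ) (θ : Terms L FV Γ Δ)
    (e : Tup M.carrier Δ), (p.substAll θ).eval M F ρ e ↔ p.eval M F ρ (θ.eval M F e)
  | _, _, .matrix A, θ, e => CNF.eval_map_subst θ A e
  | _, _, .quant .all s p, θ, e => forall_congr' fun a => by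
      rw [eval_substAll p θ.lift, Terms.eval_lift]
  | _, _, .quant .ex s p, θ, e => exists_congr fun a => by
      rw [eval_substAll p θ.lift, Terms.eval_lift]

theorem eval_weaken {s : L.Srt} (p : Prenex L FV PV Γ) (a : M.carrier s) (e : Tup M.carrier Γ) :
    p.weaken.eval M F ρ (Tup.cons a e) ↔ p.eval M F ρ e := by
  rw [weaken, eval_substAll, Terms.eval_weaken, Terms.eval_id]

/-- `merge` computes a connective, provided that quantifiers over nonempty carriers can be pulled
out of it. -/
theorem eval_merge {op : {Γ : List L.Srt} → CNF L FV PV Γ → CNF L FV PV Γ → CNF L FV PV Γ}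
    {c : Prop → Prop → Prop} (hcomm : ∀ p q, c p q ↔ c q p)
    (hop : ∀ {Γ : List L.Srt} (A B : CNF L FV PV Γ) (e : Tup M.carrier Γ),
      (op A B).eval M F ρ e ↔ c (A.eval M F ρ e) (B.eval M F ρ e))
    (hall : ∀ {α : Type v} [Nonempty α] (p : α → Prop) (q : Prop),
      (∀ a, c (p a) q) ↔ c (∀ a, p a) q)
    (hex : ∀ {α : Type v} [Nonempty α] (p : α → Prop) (q : Prop),
      (∃ a, c (p a) q) ↔ c (∃ a, p a) q) :
    ∀ {Γ : List L.Srt} (p q : Prenex L FV PV Γ) (e : Tup M.carrier Γ),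
      (merge op p q).eval M F ρ e ↔ c (p.eval M F ρ e) (q.eval M F ρ e) := by
  have hmatrix : ∀ {Γ : List L.Srt} (A : CNF L FV PV Γ) (q : Prenex L FV PV Γ)
      (e : Tup M.carrier Γ),
      (mergeMatrix op A q).eval M F ρ e ↔ c (A.eval M F ρ e) (q.eval M F ρ e) := by
    intro Γ A q
    induction q with
    | matrix B => exact hop A B
    | quant Q s q ih =>
      intro e
      have := M.nonempty s
      cases Q with
      | all =>
        simp only [mergeMatrix, eval, ih, CNF.eval_weaken]
        simp only [hcomm (CNF.eval M F ρ A e)]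
        exact hall _ _
      | ex =>
        simp only [mergeMatrix, eval, ih, CNF.eval_weaken]
        simp only [hcomm (CNF.eval M F ρ A e)]
        exact hex _ _
  intro Γ p
  induction p with
  | matrix A => exact hmatrix A
  | quant Q s p ih =>
    intro q e
    have := M.nonempty s
    cases Q with
    | all =>
      simp only [merge, eval, ih, eval_weaken]
      exact hall _ _
    | ex =>
      simp only [merge, eval, ih, eval_weaken]
      exact hex _ _

theorem eval_merge_and (p q : Prenex L FV PV Γ) (e : Tup M.carrier Γ) :
    (merge CNF.and p q).eval M F ρ e ↔ p.eval M F ρ e ∧ q.eval M F ρ e :=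
  eval_merge (c := And) (fun _ _ => and_comm) CNF.eval_and
    (fun _ _ => forall_and_right _ _) (fun _ _ => exists_and_right) p q e

theorem eval_merge_or (p q : Prenex L FV PV Γ) (e : Tup M.carrier Γ) :
    (merge CNF.or p q).eval M F ρ e ↔ p.eval M F ρ e ∨ q.eval M F ρ e :=
  eval_merge (c := Or) (fun _ _ => or_comm) CNF.eval_or
    (fun _ _ => forall_or_right) (fun _ _ => by rw [exists_or, exists_const]) p q e

/-- All quantifiers of the prefix are universal. -/
def IsUniversal : {Γ : List L.Srt} → Prenex L FV PV Γ → Prop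
  | _, .matrix _ => True
  | _, .quant .all _ p => p.IsUniversal
  | _, .quant .ex _ _ => False

theorem IsUniversal.substAll : ∀ {Γ Δ : List L.Srt} {p : Prenex L FV PV Γ}
    (θ : Terms L FV Γ Δ), p.IsUniversal → (p.substAll θ).IsUniversal
  | _, _, .matrix _, _, _ => trivial
  | _, _, .quant .all _ _, θ, h => IsUniversal.substAll θ.lift h

theorem IsUniversal.merge {op : {Γ : List L.Srt} → CNF L FV PV Γ → CNF L FV PV Γ → CNF L FV PV Γ}
    {p q : Prenex L FV PV Γ} (hp : p.IsUniversal) (hq : q.IsUniversal) :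
    (Prenex.merge op p q).IsUniversal := by
  have hmatrix : ∀ {Γ : List L.Srt} (A : CNF L FV PV Γ) (q : Prenex L FV PV Γ),
      q.IsUniversal → (mergeMatrix op A q).IsUniversal := by
    intro Γ A q hq
    induction q with
    | matrix B => trivial
    | quant Q s q ih =>
      cases Q with
      | all => exact ih _ hq
      | ex => exact hq.elim
  induction p with
  | matrix A => exact hmatrix A q hq
  | quant Q s p ih =>
    cases Q with
    | all => exact ih hp (hq.substAll _)
    | ex => exact hp.elim

theorem forall_clauses_iff : ∀ {Γ : List L.Srt} {p : Prenex L FV PV Γ}, p.IsUniversal →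
    ((∀ c ∈ p.clauses, ∀ e, c.clause.eval M F ρ e) ↔ ∀ e, p.eval M F ρ e)
  | _, .matrix A, _ => by
      simp only [clauses, List.mem_map, forall_exists_index, and_imp, forall_apply_eq_imp_iff₂,
        eval, CNF.eval]
      exact ⟨fun h e c hc => h c hc e, fun h c hc e => h e c hc⟩
  | _, .quant .all s p, h => by
      refine (forall_clauses_iff (p := p) h).trans ⟨fun h e a => h _, fun h e => ?_⟩
      rw [← Tup.cons_zero_tail e]
      exact h _ _

end Prenex

namespace Formula

theorem eval_prenex : ∀ {Γ : List L.Srt} (b : Bool) (φ : Formula L FV PV Γ)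
    (e : Tup M.carrier Γ),
    (φ.prenex b).eval M F ρ e ↔ (if b then φ.eval M F ρ e else ¬ φ.eval M F ρ e)
  | _, true, .pvar X args, e => by
      simp [prenex, Prenex.eval, CNF.eval, ClauseOver.eval, QF.eval, eval]
  | _, false, .pvar X args, e => by
      simp [prenex, Prenex.eval, CNF.eval, ClauseOver.eval, QF.eval, eval]
  | _, true, .atom p args, e => by
      simp [prenex, Prenex.eval, CNF.eval, ClauseOver.eval, QF.eval, eval]
  | _, false, .atom p args, e => by
      simp [prenex, Prenex.eval, CNF.eval, ClauseOver.eval, QF.eval, eval]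
  | _, true, .neg φ, e => by simpa [prenex, eval] using eval_prenex false φ e
  | _, false, .neg φ, e => by simpa [prenex, eval] using eval_prenex true φ e
  | _, true, .or φ ψ, e => by
      simp [prenex, eval, Prenex.eval_merge_or, eval_prenex true φ e, eval_prenex true ψ e]
  | _, false, .or φ ψ, e => by
      simp [prenex, eval, Prenex.eval_merge_and, eval_prenex false φ e, eval_prenex false ψ e]
  | _, true, .and φ ψ, e => by
      simp [prenex, eval, Prenex.eval_merge_and, eval_prenex true φ e, eval_prenex true ψ e]
  | _, false, .and φ ψ, e => by
      simp [prenex, eval, Prenex.eval_merge_or, eval_prenex false φ e, eval_prenex false ψ e,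
        imp_iff_not_or]
  | _, true, .ex s φ, e => by
      simp [prenex, eval, Prenex.eval, fun a => eval_prenex true φ (Tup.cons a e)]
  | _, false, .ex s φ, e => by
      simp [prenex, eval, Prenex.eval, fun a => eval_prenex false φ (Tup.cons a e)]
  | _, true, .all s φ, e => by
      simp [prenex, eval, Prenex.eval, fun a => eval_prenex true φ (Tup.cons a e)]
  | _, false, .all s φ, e => by
      simp [prenex, eval, Prenex.eval, fun a => eval_prenex false φ (Tup.cons a e)]

/-- `φ.IsUniversal b`: all quantifiers of `φ`, at polarity `b`, act as universal ones: there is no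
existential quantifier in the prenex normal form of `φ` (for `true`), resp. of `¬ φ`. -/
def IsUniversal : {Γ : List L.Srt} → Bool → Formula L FV PV Γ → Prop
  | _, _, .pvar _ _ => True
  | _, _, .atom _ _ => True
  | _, b, .neg φ => φ.IsUniversal (!b)
  | _, b, .or φ ψ => φ.IsUniversal b ∧ ψ.IsUniversal b
  | _, b, .and φ ψ => φ.IsUniversal b ∧ ψ.IsUniversal b
  | _, b, .ex _ φ => b = false ∧ φ.IsUniversal b
  | _, b, .all _ φ => b = true ∧ φ.IsUniversal b

theorem IsUniversal.prenex : ∀ {Γ : List L.Srt} {b : Bool} {φ : Formula L FV PV Γ},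
    φ.IsUniversal b → (φ.prenex b).IsUniversal
  | _, true, .pvar _ _, _ => trivial
  | _, false, .pvar _ _, _ => trivial
  | _, true, .atom _ _, _ => trivial
  | _, false, .atom _ _, _ => trivial
  | _, true, .neg φ, h => IsUniversal.prenex (φ := φ) h
  | _, false, .neg φ, h => IsUniversal.prenex (φ := φ) h
  | _, true, .or _ _, h => .merge (IsUniversal.prenex h.1) (IsUniversal.prenex h.2)
  | _, false, .or _ _, h => .merge (IsUniversal.prenex h.1) (IsUniversal.prenex h.2)
  | _, true, .and _ _, h => .merge (IsUniversal.prenex h.1) (IsUniversal.prenex h.2)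
  | _, false, .and _ _, h => .merge (IsUniversal.prenex h.1) (IsUniversal.prenex h.2)
  | _, false, .ex _ φ, h => IsUniversal.prenex (φ := φ) h.2
  | _, true, .all _ φ, h => IsUniversal.prenex (φ := φ) h.2

theorem IsUniversal.subst : ∀ {Γ Δ : List L.Srt} {b : Bool} {φ : Formula L FV PV Γ}
    (θ : Terms L FV Γ Δ), φ.IsUniversal b → (φ.subst θ).IsUniversal b
  | _, _, _, .pvar _ _, _, _ => trivial
  | _, _, _, .atom _ _, _, _ => trivial
  | _, _, _, .neg φ, θ, h => IsUniversal.subst (φ := φ) θ h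
  | _, _, _, .or _ _, θ, h => ⟨h.1.subst θ, h.2.subst θ⟩
  | _, _, _, .and _ _, θ, h => ⟨h.1.subst θ, h.2.subst θ⟩
  | _, _, _, .ex _ φ, θ, h => ⟨h.1, IsUniversal.subst (φ := φ) θ.lift h.2⟩
  | _, _, _, .all _ φ, θ, h => ⟨h.1, IsUniversal.subst (φ := φ) θ.lift h.2⟩

theorem IsUniversal.psubst {σ : (X : PV.Idx) → Formula L FV PV' (PV.ar X ++ Θ)}
    (hσ : ∀ X b, (σ X).IsUniversal b) : ∀ {Γ Δ : List L.Srt} {b : Bool}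
    {φ : Formula L FV PV Γ} (θ : Terms L FV Γ Δ) (π : Terms L FV Θ Δ), φ.IsUniversal b →
      (φ.psubst σ θ π).IsUniversal b
  | _, _, b, .pvar X _, _, _, _ => (hσ X b).subst _
  | _, _, _, .atom _ _, _, _, _ => trivial
  | _, _, _, .neg φ, θ, π, h => IsUniversal.psubst (φ := φ) hσ θ π h
  | _, _, _, .or _ _, θ, π, h => ⟨h.1.psubst hσ θ π, h.2.psubst hσ θ π⟩
  | _, _, _, .and _ _, θ, π, h => ⟨h.1.psubst hσ θ π, h.2.psubst hσ θ π⟩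
  | _, _, _, .ex _ φ, θ, π, h => ⟨h.1, IsUniversal.psubst (φ := φ) hσ θ.lift π.weaken h.2⟩
  | _, _, _, .all _ φ, θ, π, h => ⟨h.1, IsUniversal.psubst (φ := φ) hσ θ.lift π.weaken h.2⟩

theorem forall_cnf_iff {φ : Formula L FV PV Γ} (hφ : φ.IsUniversal true) :
    (∀ c ∈ φ.cnf, ∀ e, c.clause.eval M F ρ e) ↔ ∀ e, φ.eval M F ρ e := by
  rw [cnf, Prenex.forall_clauses_iff hφ.prenex]
  simp only [eval_prenex, if_true]

end Formula

end Prenex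

/-! ### Nested fixpoints -/

section Fixpoints

variable {L : Signature.{u}} {M : Struc.{u, v} L} {w : List L.Srt}

theorem FP_mu_apply {G : Pred M w → Pred M w} {e : Tup M.carrier w} :
    FP .mu G e ↔ ∀ q, G q ≤ q → q e := by
  simp [FP, sInf_apply]

theorem FP_nu_apply {G : Pred M w → Pred M w} {e : Tup M.carrier w} :
    FP .nu G e ↔ ∃ q, q ≤ G q ∧ q e := by
  simp [FP, sSup_apply]

/-- A comparison of fixpoints on tuples of different sorts: membership of `ext y` in the one
implies membership of `y` in the other. -/
theorem FP_transport {L' : Signature.{u}} {M' : Struc.{u, v} L'} {w' : List L'.Srt}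
    {G' : Pred M' w' → Pred M' w'} {G : Pred M w → Pred M w}
    (ext : Tup M.carrier w → Tup M'.carrier w')
    (H : ∀ q' q, (∀ y, q' (ext y) → q y) → ∀ y, G' q' (ext y) → G q y) (κ : Kind)
    (y : Tup M.carrier w) (hy : FP κ G' (ext y)) : FP κ G y := by
  cases κ with
  | mu =>
    rw [FP_mu_apply] at hy ⊢
    intro q hq
    exact hy (fun e => ∀ y, e = ext y → q y)
      (fun e he y hey => hq y (H _ q (fun y hy => hy y rfl) y (hey ▸ he))) y rfl
  | nu =>
    rw [FP_nu_apply] at hy ⊢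
    obtain ⟨q', hq', hy⟩ := hy
    exact ⟨fun y => q' (ext y), fun y hy => H q' _ (fun _ h => h) y (hq' _ hy), hy⟩

theorem FP_congr {L' : Signature.{u}} {M' : Struc.{u, v} L'} {w' : List L'.Srt}
    {G' : Pred M' w' → Pred M' w'} {G : Pred M w → Pred M w}
    (f : Tup M'.carrier w' ≃ Tup M.carrier w)
    (H : ∀ q' q, (∀ y, q' y ↔ q (f y)) → ∀ y, G' q' y ↔ G q (f y)) (κ : Kind)
    (y : Tup M'.carrier w') : FP κ G' y ↔ FP κ G (f y) := by
  have H₁ : ∀ q y, G' (fun y => q (f y)) y ↔ G q (f y) := fun q => H _ q fun _ => Iff.rfl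
  have H₂ : ∀ q' y, G' q' y ↔ G (fun z => q' (f.symm z)) (f y) := fun q' =>
    H q' _ fun y => by rw [f.symm_apply_apply]
  cases κ with
  | mu =>
    simp only [FP_mu_apply]
    refine ⟨fun h q hq => h _ fun y hy => hq _ ((H₁ q y).1 hy), fun h q' hq' => ?_⟩
    have := h (fun z => q' (f.symm z)) fun z hz => by
      refine hq' _ ((H₂ _ _).2 ?_)
      rwa [f.apply_symm_apply]
    rwa [f.symm_apply_apply] at this
  | nu =>
    simp only [FP_nu_apply]
    constructor
    · rintro ⟨q', hq', hy⟩
      refine ⟨fun z => q' (f.symm z), fun z hz => ?_, by simpa using hy⟩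
      have := (H₂ _ _).1 (hq' _ hz)
      rwa [f.apply_symm_apply] at this
    · rintro ⟨q, hq, hy⟩
      exact ⟨fun y => q (f y), fun y hy => (H₁ _ _).2 (hq _ hy), hy⟩

theorem FP_eq {G : Pred M w → Pred M w} (hG : Monotone G) (κ : Kind) : G (FP κ G) = FP κ G := by
  cases κ with
  | mu => exact (OrderHom.mk G hG).map_lfp
  | nu => exact (OrderHom.mk G hG).map_gfp

end Fixpoints

namespace MuCLP

variable {L : Signature.{u}} {FV FV' : FunVars L.Srt} {W : PredVars L.Srt} {m : ℕ}
  {M : Struc.{u, v} L}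

/-- The map that sends an interpretation of the defined predicates to the interpretation given by
the bodies of their equations. -/
def op (P : MuCLP L FV W m) (M : Struc.{u, v} L) (F : FInterp M FV)
    (χ : (r : W.Idx) → Pred M (W.ar r ++ W.ar r)) (ρ : (i : Fin m) → Pred M (P.ar i)) :
    (i : Fin m) → Pred M (P.ar i) :=
  fun i e => (P.body i).eval M F (joinInterp ρ χ) e

theorem solve_succ (P : MuCLP L FV W m) (F : FInterp M FV)
    (χ : (r : W.Idx) → Pred M (W.ar r ++ W.ar r)) {j : ℕ} (h : j + 1 ≤ m) (k : Fin m)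
    (hk : (k : ℕ) = m - (j + 1)) (ρ : (i : Fin m) → Pred M (P.ar i)) :
    P.solve M F χ (j + 1) h ρ = P.solve M F χ j (Nat.le_of_succ_le h) (Function.update ρ k
      (FP (P.kind k) fun q => P.op M F χ
        (P.solve M F χ j (Nat.le_of_succ_le h) (Function.update ρ k q)) k)) := by
  obtain ⟨k, hkm⟩ := k
  subst hk
  rfl

/-- Solving the last `j` equations leaves the interpretation of the earlier predicates alone. -/
theorem solve_of_lt (P : MuCLP L FV W m) (F : FInterp M FV)
    (χ : (r : W.Idx) → Pred M (W.ar r ++ W.ar r)) : ∀ (j : ℕ) (h : j ≤ m)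
    (ρ : (i : Fin m) → Pred M (P.ar i)) (i : Fin m), (i : ℕ) < m - j →
      P.solve M F χ j h ρ i = ρ i
  | 0, _, _, _, _ => rfl
  | j + 1, h, ρ, i, hi => by
    obtain ⟨k, hk⟩ : ∃ k : Fin m, (k : ℕ) = m - (j + 1) := ⟨⟨_, by omega⟩, rfl⟩
    rw [P.solve_succ F χ h k hk, P.solve_of_lt F χ j _ _ i (by omega), Function.update_of_ne]
    rintro rfl
    omega

/-- The bodies of the equations are monotone in the defined predicates. -/
def Mono (P : MuCLP L FV W m) (M : Struc.{u, v} L) (F : FInterp M FV) : Prop :=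
  ∀ χ, Monotone (P.op M F χ)

theorem mono_of_positive {P : MuCLP L FV W m} (h : ∀ i, (P.body i).Positive)
    (F : FInterp M FV) : P.Mono M F := by
  intro χ ρ ρ' hρ i e
  refine (h i).eval_mono ?_
  rintro (j | r)
  · exact hρ j
  · exact le_rfl

theorem update_le_update {ar : Fin m → List L.Srt} {ρ ρ' : (i : Fin m) → Pred M (ar i)}
    {j : ℕ} {k : Fin m} (hk : (k : ℕ) = m - (j + 1))
    (hρ : ∀ i : Fin m, (i : ℕ) < m - (j + 1) → ρ i ≤ ρ' i) {q q' : Pred M (ar k)} (hq : q ≤ q')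
    (i : Fin m) (hi : (i : ℕ) < m - j) : Function.update ρ k q i ≤ Function.update ρ' k q' i := by
  by_cases hik : i = k
  · subst hik
    simpa using hq
  · rw [Function.update_of_ne hik, Function.update_of_ne hik]
    exact hρ i (by have := Fin.val_ne_of_ne hik; omega)

/-- Programs with the same predicates are compared equation by equation; of the given
interpretation only the part that belongs to the earlier equations matters. -/
theorem solve_le_solve (P : MuCLP L FV W m) {F : FInterp M FV} {F' : FInterp M FV'}
    {χ : (r : W.Idx) → Pred M (W.ar r ++ W.ar r)}
    {body' : (i : Fin m) → Formula L FV' (progVars P.ar W) (P.ar i)}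
    (H : ∀ ρ ρ', ρ ≤ ρ' → op ⟨P.ar, P.kind, body'⟩ M F' χ ρ ≤ P.op M F χ ρ') :
    ∀ (j : ℕ) (h : j ≤ m) (ρ ρ' : (i : Fin m) → Pred M (P.ar i)),
      (∀ i : Fin m, (i : ℕ) < m - j → ρ i ≤ ρ' i) →
      solve ⟨P.ar, P.kind, body'⟩ M F' χ j h ρ ≤ P.solve M F χ j h ρ'
  | 0, _, _, _, hρ => fun i => hρ i i.2
  | j + 1, h, ρ, ρ', hρ => by
    obtain ⟨k, hk⟩ : ∃ k : Fin m, (k : ℕ) = m - (j + 1) := ⟨⟨_, by omega⟩, rfl⟩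
    rw [P.solve_succ F χ h k hk, solve_succ ⟨P.ar, P.kind, body'⟩ F' χ h k hk]
    refine solve_le_solve P H j _ _ _ (update_le_update hk hρ ?_)
    refine FP_transport (fun y => y) ?_ _
    intro q' q hq y hy
    exact H _ _ (solve_le_solve P H j _ _ _ (update_le_update hk hρ hq)) _ _ hy

theorem solve_mono {P : MuCLP L FV W m} {F : FInterp M FV} (hP : P.Mono M F)
    {χ : (r : W.Idx) → Pred M (W.ar r ++ W.ar r)} {j : ℕ} {h : j ≤ m}
    {ρ ρ' : (i : Fin m) → Pred M (P.ar i)} (hρ : ∀ i : Fin m, (i : ℕ) < m - j → ρ i ≤ ρ' i) :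
    P.solve M F χ j h ρ ≤ P.solve M F χ j h ρ' :=
  P.solve_le_solve (body' := P.body) (fun _ _ h => hP χ h) j h ρ ρ' hρ

theorem op_solve_mono {P : MuCLP L FV W m} {F : FInterp M FV} (hP : P.Mono M F)
    (χ : (r : W.Idx) → Pred M (W.ar r ++ W.ar r)) {j : ℕ} (h : j + 1 ≤ m) (k : Fin m)
    (hk : (k : ℕ) = m - (j + 1)) (ρ : (i : Fin m) → Pred M (P.ar i)) :
    Monotone fun q => P.op M F χ
      (P.solve M F χ j (Nat.le_of_succ_le h) (Function.update ρ k q)) k :=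
  fun _ _ hq => hP χ (solve_mono hP (update_le_update hk (fun _ _ => le_rfl) hq)) k

/-- If all equations are greatest fixpoint equations, then nested and simultaneous greatest
fixpoints agree: a post-fixpoint of all the equations is below the interpretation of the
program. -/
theorem le_solve_of_nu {P : MuCLP L FV W m} {F : FInterp M FV} (hP : P.Mono M F)
    (hν : ∀ i, P.kind i = .nu) {χ : (r : W.Idx) → Pred M (W.ar r ++ W.ar r)}
    {ρ₀ : (i : Fin m) → Pred M (P.ar i)} (h₀ : ρ₀ ≤ P.op M F χ ρ₀) :
    ∀ (j : ℕ) (h : j ≤ m) (ρ : (i : Fin m) → Pred M (P.ar i)),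
      (∀ i : Fin m, (i : ℕ) < m - j → ρ₀ i ≤ ρ i) → ρ₀ ≤ P.solve M F χ j h ρ
  | 0, _, _, hρ => fun i => hρ i i.2
  | j + 1, h, ρ, hρ => by
    obtain ⟨k, hk⟩ : ∃ k : Fin m, (k : ℕ) = m - (j + 1) := ⟨⟨_, by omega⟩, rfl⟩
    have hu : ∀ q, ρ₀ k ≤ q → ∀ i : Fin m, (i : ℕ) < m - j →
        ρ₀ i ≤ Function.update ρ k q i := by
      intro q hq i hi
      have := update_le_update hk hρ hq i hi
      rwa [Function.update_eq_self] at this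
    rw [P.solve_succ F χ h k hk]
    refine le_solve_of_nu hP hν h₀ j _ _ (hu _ ?_)
    rw [hν]
    intro e he
    exact FP_nu_apply.2 ⟨_, fun e he =>
      hP χ (le_solve_of_nu hP hν h₀ j _ _ (hu _ le_rfl)) _ _ (h₀ _ _ he), he⟩

end MuCLP

/-! ### The theory extended by Booleans -/

section ToBool

variable {L : Signature.{u}} {Γ : List L.Srt} {M : Struc.{u, v} L}
  {d : (s : L.Srt) → M.carrier s}

/-- Tuples of sorts of `L` in the extended structure are tuples in the given structure. -/
def Tup.unbool (d : (s : L.Srt) → M.carrier s) (Γ : List L.Srt) :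
    Tup (M.withBool d).carrier (Γ.map some) ≃ Tup M.carrier Γ where
  toFun := Tup.unmapSome (D := BoolCarrier M.carrier)
  invFun := Tup.mapSome (D := BoolCarrier M.carrier)
  left_inv := Tup.mapSome_unmapSome (D := BoolCarrier M.carrier)
  right_inv := Tup.unmapSome_mapSome (D := BoolCarrier M.carrier)

theorem Var.unbool_apply {t : L.Srt} : ∀ {Γ : List L.Srt} (x : Var Γ t)
    (e : Tup (M.withBool d).carrier (Γ.map some)), e (some t) x.toBool = Tup.unbool d Γ e t x
  | _ :: _, .zero, _ => rfl
  | _ :: Γ, .succ x, e =>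
    Var.unbool_apply x (Tup.tail (Γ := (Γ.map some : List L.withBool.Srt)) e)

theorem Tup.unbool_eval_mapSome {FV : FunVars L.withBool.Srt}
    {F : FInterp (M.withBool d) FV} {Δ : List L.withBool.Srt}
    (e : Tup (M.withBool d).carrier Δ) :
    ∀ {w : List L.Srt} (ts : Tup (fun t => Term L.withBool FV Δ (some t)) w),
    Tup.unbool d w (Terms.eval (M.withBool d) F
      (Tup.mapSome (D := Term L.withBool FV Δ) ts) e) =
        fun t x => (ts t x).eval (M.withBool d) F e
  | [], _ => (Tup.eq_nil _).trans (Tup.eq_nil _).symm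
  | _ :: _, ts => by
    funext t x
    cases x with
    | zero => rfl
    | succ x => exact congrFun (congrFun (Tup.unbool_eval_mapSome e ts.tail) t) x

theorem Term.eval_toBool (F : FInterp M (noFV L.Srt))
    (F' : FInterp (M.withBool d) (noFV L.withBool.Srt))
    (e : Tup (M.withBool d).carrier (Γ.map some)) {s : L.Srt} (t : Term L (noFV L.Srt) Γ s) :
    t.toBool.eval (M.withBool d) F' e = t.eval M F (Tup.unbool d Γ e) := by
  induction t with
  | var x => exact Var.unbool_apply x e
  | fvar f args ih => exact f.elim
  | fn f args ih =>
    refine congrArg (M.fnI f) ((Tup.unbool_eval_mapSome e _).trans ?_)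
    funext t x
    exact ih t x

theorem Terms.eval_toBool (F : FInterp M (noFV L.Srt))
    (F' : FInterp (M.withBool d) (noFV L.withBool.Srt)) {w : List L.Srt}
    (e : Tup (M.withBool d).carrier (Γ.map some)) (ts : Terms L (noFV L.Srt) w Γ) :
    Tup.unbool d w (ts.toBool.eval (M.withBool d) F' e) = ts.eval M F (Tup.unbool d Γ e) := by
  refine (Tup.unbool_eval_mapSome e _).trans ?_
  funext t x
  exact Term.eval_toBool F F' e _

theorem Formula.eval_toBool {m : ℕ} {ar : Fin m → List L.Srt} {F : FInterp M (noFV L.Srt)}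
    {F' : FInterp (M.withBool d) (noFV L.withBool.Srt)}
    {ρ : (i : Fin m) → Pred M (ar i)}
    {ρ' : (i : Fin m) → Pred (M.withBool d) ((ar i).map some)}
    {χ : (r : Empty) → Pred M ((noPV L.Srt).ar r ++ (noPV L.Srt).ar r)}
    {χ' : (r : Empty) → Pred (M.withBool d)
      ((noPV L.withBool.Srt).ar r ++ (noPV L.withBool.Srt).ar r)}
    (hρ : ∀ i y, ρ' i y ↔ ρ i (Tup.unbool d _ y)) :
    ∀ {Γ : List L.Srt} (φ : Formula L (noFV L.Srt) (progVars ar (noPV L.Srt)) Γ)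
    (e : Tup (M.withBool d).carrier (Γ.map some)),
    φ.toBool.eval (M.withBool d) F'
      (joinInterp (W := noPV L.withBool.Srt) ρ' χ') e ↔
      φ.eval M F (joinInterp (W := noPV L.Srt) ρ χ) (Tup.unbool d Γ e)
  | _, .pvar (.inl i) args, e => by
    refine (hρ i _).trans (iff_of_eq (congrArg (ρ i) ?_))
    exact Terms.eval_toBool F F' e args
  | _, .pvar (.inr r) _, _ => nomatch r
  | _, .atom p args, e => iff_of_eq (congrArg (M.prI p) (Terms.eval_toBool F F' e args))
  | _, .neg φ, e => not_congr (eval_toBool hρ φ e)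
  | _, .or φ ψ, e => or_congr (eval_toBool hρ φ e) (eval_toBool hρ ψ e)
  | _, .and φ ψ, e => and_congr (eval_toBool hρ φ e) (eval_toBool hρ ψ e)
  | _, .ex s φ, e => exists_congr fun a => eval_toBool hρ φ (Tup.cons (s := some s) a e)
  | _, .all s φ, e => forall_congr' fun a => eval_toBool hρ φ (Tup.cons (s := some s) a e)

theorem ClosedMuCLP.solve_toBool {m : ℕ} (P : ClosedMuCLP L m) {F : FInterp M (noFV L.Srt)}
    {F' : FInterp (M.withBool d) (noFV L.withBool.Srt)}
    {χ : (r : Empty) → Pred M ((noPV L.Srt).ar r ++ (noPV L.Srt).ar r)}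
    {χ' : (r : Empty) → Pred (M.withBool d)
      ((noPV L.withBool.Srt).ar r ++ (noPV L.withBool.Srt).ar r)} :
    ∀ (j : ℕ) (h : j ≤ m) (ρ : (i : Fin m) → Pred M (P.ar i))
    (ρ' : (i : Fin m) → Pred (M.withBool d) (P.toBool.ar i)),
    (∀ i y, ρ' i y ↔ ρ i (Tup.unbool d _ y)) → ∀ i y,
      P.toBool.solve (M.withBool d) F' χ' j h ρ' i y ↔
        P.solve M F χ j h ρ i (Tup.unbool d _ y)
  | 0, _, _, _, hρ => hρ
  | j + 1, h, ρ, ρ', hρ => by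
    obtain ⟨k, hk⟩ : ∃ k : Fin m, (k : ℕ) = m - (j + 1) := ⟨⟨_, by omega⟩, rfl⟩
    have hu : ∀ (q' : Pred (M.withBool d) (P.toBool.ar k)) (q : Pred M (P.ar k)),
        (∀ y, q' y ↔ q (Tup.unbool d _ y)) → ∀ i y,
        Function.update ρ' k q' i y ↔ Function.update ρ k q i (Tup.unbool d _ y) := by
      intro q' q hq i
      by_cases hi : i = k
      · subst hi
        simpa using hq
      · simpa [Function.update_of_ne hi] using hρ i
    rw [P.solve_succ F χ h k hk, P.toBool.solve_succ F' χ' h k hk]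
    refine solve_toBool P j _ _ _ (hu _ _ (FP_congr (Tup.unbool d _) ?_ _))
    intro q' q hq y
    exact Formula.eval_toBool (solve_toBool P j _ _ _ (hu q' q hq)) _ _

theorem ClosedMuCLP.models_toBool {m : ℕ} (P : ClosedMuCLP L m) (φ : P.Query Γ)
    (d : (s : L.Srt) → M.carrier s) :
    P.toBool.Models (M.withBool d) φ.toBool ↔ P.Models M φ := by
  refine (Tup.unbool d Γ).forall_congr fun {e} => ?_
  exact Formula.eval_toBool (ar := P.ar)
    (P.solve_toBool m le_rfl (fun _ _ => False) (fun _ _ => False) fun _ _ => Iff.rfl) φ e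

theorem Formula.OccursOnly.toBool {m : ℕ} {ar : Fin m → List L.Srt} :
    ∀ {Γ : List L.Srt} {b : Bool} {φ : Formula L (noFV L.Srt) (progVars ar (noPV L.Srt)) Γ},
      φ.OccursOnly b → φ.toBool.OccursOnly b
  | _, _, .pvar (.inl _) _, h => h
  | _, _, .pvar (.inr r) _, _ => nomatch r
  | _, _, .atom _ _, _ => trivial
  | _, _, .neg φ, h => OccursOnly.toBool (φ := φ) h
  | _, _, .or _ _, h => ⟨h.1.toBool, h.2.toBool⟩
  | _, _, .and _ _, h => ⟨h.1.toBool, h.2.toBool⟩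
  | _, _, .ex _ φ, h => OccursOnly.toBool (φ := φ) h
  | _, _, .all _ φ, h => OccursOnly.toBool (φ := φ) h

end ToBool

/-! ### Skolemization -/

section Skolem

/-- Implication from `p` to `q` at positive polarity, from `q` to `p` at negative polarity. -/
def PolImp (b : Bool) (p q : Prop) : Prop := if b then p → q else q → p

namespace PolImp

variable {b : Bool} {p q p' q' : Prop}

theorem of_iff (h : p ↔ q) : PolImp b p q := by
  cases b
  · exact h.2
  · exact h.1

theorem neg (h : PolImp (!b) p q) : PolImp b (¬ p) (¬ q) := by
  cases b
  · exact mt (show p → q from h)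
  · exact mt (show q → p from h)

theorem or (h : PolImp b p q) (h' : PolImp b p' q') : PolImp b (p ∨ p') (q ∨ q') := by
  cases b <;> exact Or.imp h h'

theorem and (h : PolImp b p q) (h' : PolImp b p' q') : PolImp b (p ∧ p') (q ∧ q') := by
  cases b <;> exact And.imp h h'

theorem ex {α : Type*} {p q : α → Prop} (h : ∀ a, PolImp b (p a) (q a)) :
    PolImp b (∃ a, p a) (∃ a, q a) := by
  cases b <;> exact Exists.imp h

theorem all {α : Type*} {p q : α → Prop} (h : ∀ a, PolImp b (p a) (q a)) :
    PolImp b (∀ a, p a) (∀ a, q a) := by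
  cases b <;> exact forall_imp h

end PolImp

variable {L : Signature.{u}} {PV : PredVars L.Srt} {Γ Δ : List L.Srt} {m : ℕ}
  {M : Struc.{u, v} L}

namespace Formula

theorem OccursOnly.skolem {o : Option (Fin m)} {c : Bool} :
    ∀ {Γ Δ : List L.Srt} {b : Bool} {l : List Bool} {φ : Formula L (noFV L.Srt) PV Γ}
    (θ : Terms L (SkolemVar L.Srt m) Γ Δ), φ.OccursOnly c → (φ.skolem o b l θ).OccursOnly c
  | _, _, _, _, .pvar _ _, _, h => h
  | _, _, _, _, .atom _ _, _, _ => trivial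
  | _, _, _, _, .neg φ, θ, h => OccursOnly.skolem (φ := φ) θ h
  | _, _, _, _, .or _ _, θ, h => ⟨h.1.skolem θ, h.2.skolem θ⟩
  | _, _, _, _, .and _ _, θ, h => ⟨h.1.skolem θ, h.2.skolem θ⟩
  | _, _, true, _, .ex _ φ, _, h => OccursOnly.skolem (φ := φ) _ h
  | _, _, false, _, .ex _ φ, _, h => OccursOnly.skolem (φ := φ) _ h
  | _, _, true, _, .all _ φ, _, h => OccursOnly.skolem (φ := φ) _ h
  | _, _, false, _, .all _ φ, _, h => OccursOnly.skolem (φ := φ) _ h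

theorem isUniversal_skolem {o : Option (Fin m)} :
    ∀ {Γ Δ : List L.Srt} (b : Bool) (l : List Bool) (φ : Formula L (noFV L.Srt) PV Γ)
    (θ : Terms L (SkolemVar L.Srt m) Γ Δ), (φ.skolem o b l θ).IsUniversal b
  | _, _, _, _, .pvar _ _, _ => trivial
  | _, _, _, _, .atom _ _, _ => trivial
  | _, _, _, _, .neg φ, θ => isUniversal_skolem _ _ φ θ
  | _, _, _, _, .or φ ψ, θ => ⟨isUniversal_skolem _ _ φ θ, isUniversal_skolem _ _ ψ θ⟩
  | _, _, _, _, .and φ ψ, θ => ⟨isUniversal_skolem _ _ φ θ, isUniversal_skolem _ _ ψ θ⟩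
  | _, _, true, _, .ex _ φ, _ => isUniversal_skolem _ _ φ _
  | _, _, false, _, .ex _ φ, _ => ⟨rfl, isUniversal_skolem _ _ φ _⟩
  | _, _, true, _, .all _ φ, _ => ⟨rfl, isUniversal_skolem _ _ φ _⟩
  | _, _, false, _, .all _ φ, _ => isUniversal_skolem _ _ φ _

theorem polImp_skolem {o : Option (Fin m)} {F : FInterp M (SkolemVar L.Srt m)}
    {F₀ : FInterp M (noFV L.Srt)} {ρ : PInterp M PV} :
    ∀ {Γ Δ : List L.Srt} (b : Bool) (l : List Bool) (φ : Formula L (noFV L.Srt) PV Γ)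
    (θ : Terms L (SkolemVar L.Srt m) Γ Δ) (e : Tup M.carrier Δ),
    PolImp b ((φ.skolem o b l θ).eval M F ρ e) (φ.eval M F₀ ρ (θ.eval M F e))
  | _, _, _, _, .pvar X args, θ, e => .of_iff <| by
      simp only [skolem, eval, Terms.eval_subst, Terms.eval_ofClosed F₀]
  | _, _, _, _, .atom p args, θ, e => .of_iff <| by
      simp only [skolem, eval, Terms.eval_subst, Terms.eval_ofClosed F₀]
  | _, _, _, _, .neg φ, θ, e => .neg (polImp_skolem _ _ φ θ e)
  | _, _, _, _, .or φ ψ, θ, e => .or (polImp_skolem _ _ φ θ e) (polImp_skolem _ _ ψ θ e)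
  | _, _, _, _, .and φ ψ, θ, e => .and (polImp_skolem _ _ φ θ e) (polImp_skolem _ _ ψ θ e)
  | _, Δ, true, l, .ex s φ, θ, e => fun h => by
      have := polImp_skolem (F₀ := F₀) (F := F) (ρ := ρ) (o := o) true (false :: l) φ
        (Tup.cons (.fvar (w := Δ) (s := s) ⟨o, l⟩ Terms.id) θ) e h
      rw [Terms.eval_cons] at this
      exact ⟨_, this⟩
  | _, _, false, l, .ex s φ, θ, e => .ex fun a => by
      have := polImp_skolem (F₀ := F₀) (F := F) (ρ := ρ) (o := o) false (false :: l) φ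
        θ.lift (Tup.cons a e)
      rwa [Terms.eval_lift] at this
  | _, _, true, l, .all s φ, θ, e => .all fun a => by
      have := polImp_skolem (F₀ := F₀) (F := F) (ρ := ρ) (o := o) true (false :: l) φ
        θ.lift (Tup.cons a e)
      rwa [Terms.eval_lift] at this
  | _, Δ, false, l, .all s φ, θ, e => fun h => by
      refine polImp_skolem (F₀ := F₀) (F := F) (ρ := ρ) (o := o) false (false :: l) φ
        (Tup.cons (.fvar (w := Δ) (s := s) ⟨o, l⟩ Terms.id) θ) e ?_
      rw [Terms.eval_cons]
      exact h _

/-- `F` and `F'` agree on the Skolem functions of the subformula at `l` of the formula `o`. -/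
def AgreeBelow (o : Option (Fin m)) (l : List Bool) (F F' : FInterp M (SkolemVar L.Srt m)) :
    Prop :=
  ∀ w s p, l <:+ p → F' w s ⟨o, p⟩ = F w s ⟨o, p⟩

/-- Skolem functions of the two arguments of a connective are combined according to the last step
of the path. -/
theorem exists_agreeBelow_both (o : Option (Fin m)) (l : List Bool)
    (F₁ F₂ : FInterp M (SkolemVar L.Srt m)) :
    ∃ F, ∀ F', AgreeBelow o l F F' →
      AgreeBelow o (false :: l) F₁ F' ∧ AgreeBelow o (true :: l) F₂ F' := by
  classical
  refine ⟨fun w s f => if false :: l <:+ f.path then F₁ w s f else F₂ w s f, fun F' h => ?_⟩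
  refine ⟨fun w s p hp => ?_, fun w s p hp => ?_⟩
  · rw [h w s p ((List.suffix_cons _ _).trans hp)]
    exact if_pos hp
  · rw [h w s p ((List.suffix_cons _ _).trans hp)]
    refine if_neg ?_
    rintro ⟨t, ht⟩
    obtain ⟨t', rfl⟩ := hp
    exact absurd (List.append_inj_right' ht rfl) (by simp)

/-- A Skolem function for the quantifier at `l` is added to those of its scope. -/
theorem exists_agreeBelow_witness (o : Option (Fin m)) (l : List Bool)
    (F₁ : FInterp M (SkolemVar L.Srt m)) {s : L.Srt} (g : Tup M.carrier Δ → M.carrier s) :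
    ∃ F, ∀ F', AgreeBelow o l F F' → AgreeBelow o (false :: l) F₁ F' ∧ F' Δ s ⟨o, l⟩ = g := by
  classical
  refine ⟨Function.update F₁ Δ (Function.update (F₁ Δ) s (Function.update (F₁ Δ s) ⟨o, l⟩ g)),
    fun F' h => ⟨fun w t p hp => ?_, ?_⟩⟩
  · rw [h w t p ((List.suffix_cons _ _).trans hp)]
    have hpl : p ≠ l := by
      rintro rfl
      have := hp.length_le
      simp at this
    by_cases hw : w = Δ
    · subst hw
      rw [Function.update_self]
      by_cases ht : t = s
      · subst ht
        rw [Function.update_self, Function.update_of_ne]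
        simpa using hpl
      · rw [Function.update_of_ne ht]
    · rw [Function.update_of_ne hw]
  · rw [h _ _ _ (List.suffix_refl _), Function.update_self, Function.update_self,
      Function.update_self]

/-- Skolem functions can be chosen uniformly even if the interpretation of the predicate
variables depends on the values `e` of the free variables. The Skolem functions inside `φ` are
chosen after the values `τ` of the terms `θ` that have replaced the outer variables. -/
theorem exists_skolem (o : Option (Fin m)) (F₀ : FInterp M (noFV L.Srt)) :
    ∀ {Γ Δ : List L.Srt} (b : Bool) (l : List Bool) (φ : Formula L (noFV L.Srt) PV Γ)
    (τ : Tup M.carrier Δ → Tup M.carrier Γ) (ρ : Tup M.carrier Δ → PInterp M PV),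
    ∃ F, ∀ F', AgreeBelow o l F F' →
      ∀ θ : Terms L (SkolemVar L.Srt m) Γ Δ, (∀ e, θ.eval M F' e = τ e) →
      ∀ e, PolImp b (φ.eval M F₀ (ρ e) (τ e)) ((φ.skolem o b l θ).eval M F' (ρ e) e)
  | _, _, _, _, .pvar X args, τ, ρ =>
    ⟨fun _ s _ _ => Classical.choice (M.nonempty s), fun F' _ θ hθ e => .of_iff <| by
      simp only [skolem, eval, Terms.eval_subst, Terms.eval_ofClosed F₀, hθ]⟩
  | _, _, _, _, .atom p args, τ, ρ =>
    ⟨fun _ s _ _ => Classical.choice (M.nonempty s), fun F' _ θ hθ e => .of_iff <| by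
      simp only [skolem, eval, Terms.eval_subst, Terms.eval_ofClosed F₀, hθ]⟩
  | _, _, b, l, .neg φ, τ, ρ => by
    obtain ⟨F, hF⟩ := exists_skolem o F₀ (!b) (false :: l) φ τ ρ
    exact ⟨F, fun F' h θ hθ e => .neg
      (hF F' (fun w s p hp => h w s p ((List.suffix_cons _ _).trans hp)) θ hθ e)⟩
  | _, _, b, l, .or φ ψ, τ, ρ => by
    obtain ⟨F₁, h₁⟩ := exists_skolem o F₀ b (false :: l) φ τ ρ
    obtain ⟨F₂, h₂⟩ := exists_skolem o F₀ b (true :: l) ψ τ ρ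
    obtain ⟨F, hF⟩ := exists_agreeBelow_both o l F₁ F₂
    exact ⟨F, fun F' h θ hθ e =>
      .or (h₁ F' (hF F' h).1 θ hθ e) (h₂ F' (hF F' h).2 θ hθ e)⟩
  | _, _, b, l, .and φ ψ, τ, ρ => by
    obtain ⟨F₁, h₁⟩ := exists_skolem o F₀ b (false :: l) φ τ ρ
    obtain ⟨F₂, h₂⟩ := exists_skolem o F₀ b (true :: l) ψ τ ρ
    obtain ⟨F, hF⟩ := exists_agreeBelow_both o l F₁ F₂
    exact ⟨F, fun F' h θ hθ e =>
      .and (h₁ F' (hF F' h).1 θ hθ e) (h₂ F' (hF F' h).2 θ hθ e)⟩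
  | _, _, true, l, .ex s φ, τ, ρ => by
    have := M.nonempty s
    let g e := Classical.epsilon fun a => φ.eval M F₀ (ρ e) (Tup.cons a (τ e))
    obtain ⟨F₁, h₁⟩ := exists_skolem o F₀ true (false :: l) φ (fun e => Tup.cons (g e) (τ e)) ρ
    obtain ⟨F, hF⟩ := exists_agreeBelow_witness o l F₁ g
    refine ⟨F, fun F' h θ hθ e he => ?_⟩
    obtain ⟨h₁', hg⟩ := hF F' h
    refine h₁ F' h₁' _ (fun e => ?_) e (Classical.epsilon_spec he)
    rw [Terms.eval_cons, hθ, ← hg]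
    rfl
  | _, _, false, l, .ex s φ, τ, ρ => by
    obtain ⟨F, hF⟩ := exists_skolem o F₀ false (false :: l) φ
      (fun e => Tup.cons (e s .zero) (τ e.tail)) (fun e => ρ e.tail)
    refine ⟨F, fun F' h θ hθ e => .ex fun a => ?_⟩
    refine hF F' (fun w s p hp => h w s p ((List.suffix_cons _ _).trans hp)) θ.lift (fun e => ?_)
      (Tup.cons a e)
    rw [← hθ, ← Terms.eval_lift, Tup.cons_zero_tail]
  | _, _, true, l, .all s φ, τ, ρ => by
    obtain ⟨F, hF⟩ := exists_skolem o F₀ true (false :: l) φ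
      (fun e => Tup.cons (e s .zero) (τ e.tail)) (fun e => ρ e.tail)
    refine ⟨F, fun F' h θ hθ e => .all fun a => ?_⟩
    refine hF F' (fun w s p hp => h w s p ((List.suffix_cons _ _).trans hp)) θ.lift (fun e => ?_)
      (Tup.cons a e)
    rw [← hθ, ← Terms.eval_lift, Tup.cons_zero_tail]
  | _, _, false, l, .all s φ, τ, ρ => by
    have := M.nonempty s
    let g e := Classical.epsilon fun a => ¬ φ.eval M F₀ (ρ e) (Tup.cons a (τ e))
    obtain ⟨F₁, h₁⟩ := exists_skolem o F₀ false (false :: l) φ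
      (fun e => Tup.cons (g e) (τ e)) ρ
    obtain ⟨F, hF⟩ := exists_agreeBelow_witness o l F₁ g
    refine ⟨F, fun F' h θ hθ e he => ?_⟩
    obtain ⟨h₁', hg⟩ := hF F' h
    by_contra hc
    refine Classical.epsilon_spec (not_forall.1 hc) (h₁ F' h₁' _ (fun e => ?_) e he)
    rw [Terms.eval_cons, hθ, ← hg]
    rfl

end Formula

variable {P : ClosedMuCLP L m} {F₀ : FInterp M (noFV L.Srt)}

/-- Skolem functions for all equations and the query at once; the predicate variables may be
interpreted differently for each tuple of arguments. -/
theorem exists_skolem_functions (F₀ : FInterp M (noFV L.Srt)) (φ : P.Query Γ)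
    (ρ : (i : Fin m) → Tup M.carrier (P.ar i) → PInterp M (progVars P.ar (noPV L.Srt)))
    (ρφ : PInterp M (progVars P.ar (noPV L.Srt))) :
    ∃ F, (∀ i e, (P.body i).eval M F₀ (ρ i e) e →
        ((elimExProg P).body i).eval M F (ρ i e) e) ∧
      ∀ e, φ.eval M F₀ ρφ e → (elimExQuery φ).eval M F ρφ e := by
  choose F hF using fun i =>
    Formula.exists_skolem (some i) F₀ true [] (P.body i) (fun e => e) (ρ i)
  obtain ⟨Fφ, hFφ⟩ := Formula.exists_skolem (none : Option (Fin m)) F₀ true [] φ (fun e => e)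
    fun _ => ρφ
  refine ⟨fun w s f => (f.origin.elim Fφ F) w s f, fun i => ?_, ?_⟩
  · exact hF i (fun w s f => (f.origin.elim Fφ F) w s f) (fun _ _ _ _ => rfl) Terms.id
      fun _ => rfl
  · exact hFφ (fun w s f => (f.origin.elim Fφ F) w s f) (fun _ _ _ _ => rfl) Terms.id
      fun _ => rfl

theorem eval_of_eval_elimExQuery {F : FInterp M (SkolemVar L.Srt m)} {φ : P.Query Γ}
    {ρ : PInterp M (progVars P.ar (noPV L.Srt))} {e : Tup M.carrier Γ}
    (h : (elimExQuery φ).eval M F ρ e) : φ.eval M F₀ ρ e :=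
  Formula.polImp_skolem true [] φ Terms.id e h

theorem sem_elimExProg_le (hP : P.Mono M F₀) (F : FInterp M (SkolemVar L.Srt m))
    (χ : (r : Empty) → Pred M ((noPV L.Srt).ar r ++ (noPV L.Srt).ar r)) :
    (elimExProg P).sem M F χ ≤ P.sem M F₀ χ :=
  P.solve_le_solve (body' := (elimExProg P).body) (W := noPV L.Srt)
    (fun _ _ h i e he => hP χ h i e (Formula.polImp_skolem true [] (P.body i) Terms.id e he))
    m le_rfl _ _ fun _ _ => le_rfl

end Skolem

/-! ### Signatures of ordinals -/

section Signatures

variable {m : ℕ}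

/-- `s` is lexicographically smaller than `t` within the components up to `n`. -/
def LtUpTo (n : Fin m) (s t : Fin m → Ordinal.{w}) : Prop :=
  ∃ l ≤ n, (∀ l' < l, s l' = t l') ∧ s l < t l

/-- `s` is lexicographically at most `t` within the components up to `n`. -/
def LeUpTo (n : Fin m) (s t : Fin m → Ordinal.{w}) : Prop :=
  LtUpTo n s t ∨ ∀ l ≤ n, s l = t l

variable {n k : Fin m} {r s t : Fin m → Ordinal.{w}}

theorem LtUpTo.trans (h : LtUpTo n r s) (h' : LtUpTo n s t) : LtUpTo n r t := by
  obtain ⟨l, hl, he, hlt⟩ := h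
  obtain ⟨l', hl', he', hlt'⟩ := h'
  rcases lt_trichotomy l l' with hll | rfl | hll
  · exact ⟨l, hl, fun i hi => (he i hi).trans (he' i (hi.trans hll)), he' l hll ▸ hlt⟩
  · exact ⟨l, hl, fun i hi => (he i hi).trans (he' i hi), hlt.trans hlt'⟩
  · exact ⟨l', hl', fun i hi => (he i (hi.trans hll)).trans (he' i hi), (he l' hll).symm ▸ hlt'⟩

theorem LeUpTo.trans_lt (h : LeUpTo n r s) (h' : LtUpTo n s t) : LtUpTo n r t := by
  rcases h with h | h
  · exact h.trans h'
  · obtain ⟨l, hl, he, hlt⟩ := h'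
    exact ⟨l, hl, fun i hi => (h i (hi.le.trans hl)).trans (he i hi), (h l hl).symm ▸ hlt⟩

theorem LeUpTo.of_le (h : LeUpTo n s t) (hk : k ≤ n) : LeUpTo k s t := by
  rcases h with ⟨l, hl, he, hlt⟩ | h
  · rcases le_or_gt l k with hlk | hlk
    · exact .inl ⟨l, hlk, he, hlt⟩
    · exact .inr fun i hi => he i (hi.trans_lt hlk)
  · exact .inr fun i hi => h i (hi.trans hk)

theorem wellFounded_ltUpTo (n : Fin m) : WellFounded (LtUpTo.{w} n) := by
  refine Subrelation.wf (r := Pi.Lex (· < ·) (· < ·)) ?_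
    (Pi.Lex.wellFounded _ fun _ => wellFounded_lt)
  rintro s t ⟨l, -, h⟩
  exact ⟨l, h⟩

/-- The condition on the signatures `t` of a defined atom `X i (z)` and `s` of an atom `X l (y)`
on which the truth of `X i (z)` relies: the signature does not increase within the components
that belong to both predicates, and it decreases when a least fixpoint is unfolded on the way to
the same or an inner predicate. -/
def Descends (κ : Fin m → Kind) (i l : Fin m) (s t : Fin m → Ordinal.{w}) : Prop :=
  LeUpTo (min i l) s t ∧ (κ i = .mu → i ≤ l → LtUpTo (min i l) s t)

variable {κ : Fin m → Kind} {i l : Fin m}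

theorem Descends.of_lt (h : LtUpTo (min i l) s t) : Descends κ i l s t :=
  ⟨.inl h, fun _ _ => h⟩

theorem Descends.of_eq (h : ∀ l' ≤ min i l, s l' = t l') (h' : κ i = .mu → i ≤ l → False) :
    Descends κ i l s t :=
  ⟨.inr h, fun h₁ h₂ => (h' h₁ h₂).elim⟩

/-- Changing a component in which both signatures agree, to a common value, does not matter. -/
theorem Descends.congr {s' t' : Fin m → Ordinal.{w}} (h : Descends κ i l s t) (k : Fin m)
    (hk : s k = t k) (hk' : s' k = t' k) (hs : ∀ j ≠ k, s' j = s j) (ht : ∀ j ≠ k, t' j = t j) :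
    Descends κ i l s' t' := by
  have heq : ∀ j, s j = t j → s' j = t' j := by
    intro j hj
    by_cases h : j = k
    · rw [h, hk']
    · rw [hs j h, ht j h, hj]
  have hlt : ∀ {n}, LtUpTo n s t → LtUpTo n s' t' := by
    rintro n ⟨j, hj, he, hlt⟩
    have hjk : j ≠ k := by
      rintro rfl
      exact hlt.ne hk
    exact ⟨j, hj, fun j' hj' => heq j' (he j' hj'), by rwa [hs j hjk, ht j hjk]⟩
  exact ⟨h.1.imp hlt fun h j hj => heq j (h j hj), fun h₁ h₂ => hlt (h.2 h₁ h₂)⟩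

end Signatures

namespace MuCLP

variable {L : Signature.{u}} {FV : FunVars L.Srt} {W : PredVars L.Srt} {m : ℕ}
  {M : Struc.{u, v} L}

open OrdinalApprox in
/-- Every true atom `X i (z)` of a nested fixpoint has a signature of ordinals such that the body
of its equation holds if only atoms whose signature descends are used. The component of the
signature at a least fixpoint variable is the first stage of the approximation of this variable
from below at which the atom becomes true. -/
theorem exists_signature {P : MuCLP L FV W m} {F : FInterp M FV} (hP : P.Mono M F)
    (χ : (r : W.Idx) → Pred M (W.ar r ++ W.ar r)) :
    ∀ (j : ℕ) (h : j ≤ m) (ρ : (i : Fin m) → Pred M (P.ar i)),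
    ∃ sig : (i : Fin m) → Tup M.carrier (P.ar i) → Fin m → Ordinal.{max u v},
      (∀ i z (l : Fin m), (l : ℕ) < m - j → sig i z l = 0) ∧
      ∀ i : Fin m, m - j ≤ (i : ℕ) → ∀ z, P.solve M F χ j h ρ i z →
        P.op M F χ (fun l y => P.solve M F χ j h ρ l y ∧
          (m - j ≤ (l : ℕ) → Descends P.kind i l (sig l y) (sig i z))) i z
  | 0, _, _ => ⟨fun _ _ _ => 0, fun _ _ _ _ => rfl, fun i hi => absurd i.2 (by omega)⟩
  | j + 1, h, ρ => by
    obtain ⟨k, hk⟩ : ∃ k : Fin m, (k : ℕ) = m - (j + 1) := ⟨⟨_, by omega⟩, rfl⟩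
    rw [P.solve_succ F χ h k hk]
    have hG := op_solve_mono hP χ h k hk ρ
    set S := fun q => P.solve M F χ j (Nat.le_of_succ_le h) (Function.update ρ k q) with hS
    set G : Pred M (P.ar k) → Pred M (P.ar k) := fun q => P.op M F χ (S q) k with hGdef
    have hSmono : Monotone S := fun q q' hq =>
      solve_mono hP (update_le_update hk (fun _ _ => le_rfl) hq)
    have hSk : ∀ q, S q k = q := fun q => by
      rw [hS]
      simp only
      rw [P.solve_of_lt F χ j _ _ k (by omega), Function.update_self]
    set q₀ := FP (P.kind k) G with hq₀
    have hfix : G q₀ = q₀ := FP_eq hG _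
    change ∃ sig : (i : Fin m) → Tup M.carrier (P.ar i) → Fin m → Ordinal.{max u v},
      (∀ i z (l : Fin m), (l : ℕ) < m - (j + 1) → sig i z l = 0) ∧
      ∀ i : Fin m, m - (j + 1) ≤ (i : ℕ) → ∀ z, S q₀ i z →
        P.op M F χ (fun l y => S q₀ l y ∧
          (m - (j + 1) ≤ (l : ℕ) → Descends P.kind i l (sig l y) (sig i z))) i z
    have hle : ∀ l : Fin m, l ≤ k → (l : ℕ) < m - j := fun l hl => by
      have : (l : ℕ) ≤ k := hl
      omega
    have hgt : ∀ i : Fin m, m - (j + 1) ≤ (i : ℕ) → i ≠ k → k < i ∧ m - j ≤ (i : ℕ) := by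
      intro i hi hik
      have := Fin.val_ne_of_ne hik
      exact ⟨Fin.lt_def.2 (by omega), by omega⟩
    cases hκ : P.kind k with
    | nu =>
      -- The component of a greatest fixpoint variable is constantly `0`.
      obtain ⟨sig, hsig, H⟩ := exists_signature hP χ j (Nat.le_of_succ_le h)
        (Function.update ρ k q₀)
      refine ⟨sig, fun i z l hl => hsig i z l (by omega), fun i hi z hz => ?_⟩
      by_cases hik : i = k
      · subst hik
        rw [hSk, ← hfix] at hz
        refine hP χ (fun l y hy => ⟨hy, fun _ => .of_eq (fun l' hl' => ?_) ?_⟩) _ _ hz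
        · have := hle l' (hl'.trans (min_le_left _ _))
          rw [hsig _ _ _ this, hsig _ _ _ this]
        · rw [hκ]
          exact fun h => absurd h (by decide)
      · obtain ⟨hki, hi'⟩ := hgt i hi hik
        refine hP χ (fun l y hy => ⟨hy.1, fun hl => ?_⟩) _ _ (H i hi' z hz)
        by_cases hlk : l = k
        · subst hlk
          refine .of_eq (fun l' hl' => ?_) fun _ h => absurd hki h.not_gt
          have := hle l' (hl'.trans (min_le_right _ _))
          rw [hsig _ _ _ this, hsig _ _ _ this]
        · exact hy.2 (hgt l hl hlk).2
    | mu =>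
      -- The stages of the approximation of the least fixpoint `q₀` from below.
      let A : Ordinal.{max u v} → Pred M (P.ar k) := lfpApprox ⟨G, hG⟩ ⊥
      have hAle : ∀ α, A α ≤ q₀ := fun α =>
        lfpApprox_le_of_mem_fixedPoints _ hfix bot_le α
      obtain ⟨γ, hγ⟩ : ∃ γ, A γ = q₀ := by
        obtain ⟨γ, hγ⟩ := lfp_mem_range_lfpApprox (⟨G, hG⟩ : Pred M (P.ar k) →o Pred M (P.ar k))
        refine ⟨γ, hγ.trans ?_⟩
        rw [hq₀, hκ]
        rfl
      have hAlt : ∀ α z, A α z → ∃ β < α, G (A β) z := by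
        intro α z hz
        change lfpApprox ⟨G, hG⟩ ⊥ α z at hz
        rw [lfpApprox] at hz
        simpa [Pi.sup_apply, iSup_apply] using hz
      choose sigA hsigA HA using fun α => exists_signature hP χ j (Nat.le_of_succ_le h)
        (Function.update ρ k (A α))
      -- The first stage at which an atom is true; it becomes the component `k` of the signature,
      -- and the later components are those at this stage.
      let rank (i : Fin m) (z : Tup M.carrier (P.ar i)) : Ordinal.{max u v} :=
        sInf {α | S (A α) i z}
      have hrank : ∀ i z, S q₀ i z → S (A (rank i z)) i z := fun i z hz =>
        csInf_mem (s := {α | S (A α) i z}) ⟨γ, show S (A γ) i z by rwa [hγ]⟩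
      have hrank_le : ∀ {i z α}, S (A α) i z → rank i z ≤ α := fun hz => csInf_le' hz
      let sig (i : Fin m) (z : Tup M.carrier (P.ar i)) (l : Fin m) : Ordinal.{max u v} :=
        if l = k then rank i z else if i = k then 0 else sigA (rank i z) i z l
      have hsig_self : ∀ i z, sig i z k = rank i z := fun i z => if_pos rfl
      have hsig_lt : ∀ i z, ∀ l < k, sig i z l = 0 := by
        intro i z l hl
        simp only [sig, if_neg hl.ne]
        split_ifs
        · rfl
        · exact hsigA _ _ _ _ (hle l hl.le)
      have hlt : ∀ {i l : Fin m} {z y}, k ≤ min i l → rank l y < rank i z →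
          Descends P.kind i l (sig l y) (sig i z) := by
        intro i l z y hk hr
        refine .of_lt ⟨k, hk, fun l' hl' => ?_, ?_⟩
        · rw [hsig_lt _ _ _ hl', hsig_lt _ _ _ hl']
        · rwa [hsig_self, hsig_self]
      refine ⟨sig, fun i z l hl => hsig_lt i z l (Fin.lt_def.2 (by omega)), fun i hi z hz => ?_⟩
      by_cases hik : i = k
      · subst hik
        have hz' := hrank _ _ hz
        rw [hSk] at hz'
        -- An atom `X k (z)` relies on atoms from an earlier stage, so the component `k` drops.
        obtain ⟨β, hβ, hGz⟩ := hAlt _ _ hz'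
        refine hP χ (fun l y hy => ⟨hSmono (hAle β) l y hy, fun hl => ?_⟩) _ _ hGz
        exact hlt (le_min le_rfl (Fin.le_def.2 (by omega))) ((hrank_le hy).trans_lt hβ)
      · obtain ⟨hki, hi'⟩ := hgt i hi hik
        refine hP χ (fun l y hy => ⟨hSmono (hAle _) l y hy.1, fun hl => ?_⟩) _ _
          (HA (rank i z) i hi' z (hrank i z hz))
        have hkl : k ≤ l := Fin.le_def.2 (by omega)
        rcases (hrank_le hy.1).lt_or_eq with hr | hr
        · exact hlt (le_min hki.le hkl) hr
        by_cases hlk : l = k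
        · subst hlk
          refine .of_eq (fun l' hl' => ?_) fun _ h => absurd hki h.not_gt
          rcases (hl'.trans (min_le_right _ _)).lt_or_eq with hl' | rfl
          · rw [hsig_lt _ _ _ hl', hsig_lt _ _ _ hl']
          · rw [hsig_self, hsig_self, hr]
        · -- Both signatures are those of the same approximation, except in the component `k`.
          refine (hy.2 (hgt l hl hlk).2).congr k ?_ ?_ ?_ ?_
          · rw [hsigA _ _ _ _ (hle k le_rfl), hsigA _ _ _ _ (hle k le_rfl)]
          · rw [hsig_self, hsig_self, hr]
          · intro l' hl'
            simp only [sig, if_neg hl', if_neg hlk, hr]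
          · intro l' hl'
            simp only [sig, if_neg hl', if_neg hik]

end MuCLP

/-! ### The elimination of a least fixpoint equation -/

section Step

variable {L : Signature.{u}}

/-- The tuple `y`, extended (if `c`) in front by `b` and `x`. -/
def extTup {D : L.withBool.Srt → Type v} (c : Bool) {w u : List L.withBool.Srt}
    (b : D (none : Option L.Srt)) (x : Tup D w) (y : Tup D u) : Tup D (extAr c w u) :=
  match c with
  | true => Tup.cons b (Tup.append x y)
  | false => y

theorem exists_extTup {D : L.withBool.Srt → Type v} (c : Bool) {w u : List L.withBool.Srt}
    (b₀ : D (none : Option L.Srt)) (x₀ : Tup D w) (e : Tup D (extAr c w u)) :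
    ∃ b x y, e = extTup c b x y := by
  cases c with
  | false => exact ⟨b₀, x₀, e, rfl⟩
  | true =>
    refine ⟨e _ .zero, Tup.left (Tup.tail e), Tup.right (Γ := w) (Tup.tail e), ?_⟩
    rw [extTup, Tup.append_left_right]
    exact (Tup.cons_zero_tail (Γ := w ++ u) e).symm

theorem extTup_of_not {D : L.withBool.Srt → Type v} {p : Prop} [Decidable p] (hp : ¬ p)
    {w u : List L.withBool.Srt} (b b' : D (none : Option L.Srt)) (x x' : Tup D w) (y : Tup D u) :
    extTup (decide p) b x y = extTup (decide p) b' x' y := by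
  rw [decide_eq_false hp]
  rfl

variable {M : Struc.{u, v} L} {d : (s : L.Srt) → M.carrier s} {FV : FunVars L.withBool.Srt}
  {F : FInterp (M.withBool d) FV} {Γ Δ Θ : List L.withBool.Srt}

/-- The values of the dummy terms. -/
def dummyTup (d : (s : L.Srt) → M.carrier s) (w : List L.withBool.Srt) :
    Tup (M.withBool d).carrier w
  | none, _ => ULift.up false
  | some s, _ => d s

theorem eval_dummies (w : List L.withBool.Srt) (e : Tup (M.withBool d).carrier Γ) :
    Terms.eval (M.withBool d) F (dummies w) e = dummyTup d w := by
  funext t x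
  cases t <;> rfl

theorem eval_extArgs (c : Bool) {w u : List L.withBool.Srt} (b : Term L.withBool FV Γ none)
    (x : Terms L.withBool FV w Γ) (y : Terms L.withBool FV u Γ)
    (e : Tup (M.withBool d).carrier Γ) :
    Terms.eval (M.withBool d) F (extArgs c b x y) e =
      extTup c (b.eval (M.withBool d) F e) (x.eval (M.withBool d) F e)
        (y.eval (M.withBool d) F e) := by
  cases c with
  | false => rfl
  | true => exact (Terms.eval_cons _ _ _).trans (congrArg _ (Terms.eval_append _ _ _))

variable {m : ℕ} {ar : Fin m → List L.withBool.Srt} {W : PredVars L.withBool.Srt}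

/-- The interpretation of the predicates before the step for `X k` that results, at the values
`b`, `x` of the additional arguments, from an interpretation `ρ'` of the predicates after the step
and of the fresh variable by `R`. All three substitutions of the step have this meaning: `σ₀` at
`⊥` and the dummies, `σ_X` at `⊤` and the formal arguments, `σ_i` at the additional formal
arguments. -/
def pull (k : Fin m)
    (R : Tup (M.withBool d).carrier (ar k) → Tup (M.withBool d).carrier (ar k) → Prop)
    (b : ULift.{v} Bool) (x : Tup (M.withBool d).carrier (ar k))
    (ρ' : (i : Fin m) → Pred (M.withBool d) (stepAr ar k i)) :
    (i : Fin m) → Pred (M.withBool d) (ar i) :=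
  fun j y => ρ' j (extTup (D := (M.withBool d).carrier) (decide (k < j)) b x y) ∧
    ∀ h : k = j, b.down = true → R x (Tup.cast (congrArg ar h.symm) y)

/-- The binary relation given by a predicate on pairs of tuples. -/
def relOf {L : Signature.{u}} {M : Struc.{u, v} L} {w : List L.Srt} (q : Pred M (w ++ w)) :
    Tup M.carrier w → Tup M.carrier w → Prop :=
  fun x y => q (Tup.append x y)

/-- The restriction of an interpretation to the old well-founded variables. -/
abbrev oldInterp {L : Signature.{u}} {M : Struc.{u, v} L} {W : PredVars L.Srt} {w : List L.Srt}
    (χ' : (r : (W.add w).Idx) → Pred M ((W.add w).ar r ++ (W.add w).ar r)) :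
    (r : W.Idx) → Pred M (W.ar r ++ W.ar r) :=
  fun r => χ' (some r)

theorem pull_mono (k : Fin m)
    (R : Tup (M.withBool d).carrier (ar k) → Tup (M.withBool d).carrier (ar k) → Prop)
    (b : ULift.{v} Bool) (x : Tup (M.withBool d).carrier (ar k)) : Monotone (pull k R b x) :=
  fun _ _ h j _ hy => ⟨h j _ hy.1, hy.2⟩

variable {k i : Fin m} {ρ' : (i : Fin m) → Pred (M.withBool d) (stepAr ar k i)}
  {χ' : (r : (W.add (ar k)).Idx) →
    Pred (M.withBool d) ((W.add (ar k)).ar r ++ (W.add (ar k)).ar r)}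

theorem eval_callSubst (b : Term L.withBool FV Θ none) (x : Terms L.withBool FV (ar k) Θ)
    (guard : Option (Formula L.withBool FV (stepVars ar W k) (ar k ++ Θ)))
    (π : Tup (M.withBool d).carrier Θ)
    (hnone : guard = none → (b.eval (M.withBool d) F π).down = false)
    (hsome : ∀ g ∈ guard, ∀ y, g.eval (M.withBool d) F (joinInterp ρ' χ') (Tup.append y π) ↔
      ((b.eval (M.withBool d) F π).down = true →
        relOf (χ' none) (x.eval (M.withBool d) F π) y))
    (X : (progVars ar W).Idx) (y : Tup (M.withBool d).carrier ((progVars ar W).ar X)) :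
    (callSubst k b x guard X).eval (M.withBool d) F (joinInterp ρ' χ') (Tup.append y π) ↔
      joinInterp (pull k (relOf (χ' none)) (b.eval (M.withBool d) F π)
        (x.eval (M.withBool d) F π) ρ') (oldInterp χ') X y := by
  rcases X with j | r
  · let call : Formula L.withBool FV (stepVars ar W k) (ar j ++ Θ) :=
      .pvar (PV := stepVars ar W k) (.inl j)
        (extArgs (decide (k < j)) (b.subst Terms.inr) (x.subst Terms.inr) Terms.inl)
    have hcall : call.eval (M.withBool d) F (joinInterp ρ' χ') (Tup.append y π) ↔
        ρ' j (extTup (D := (M.withBool d).carrier) (decide (k < j))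
          (b.eval (M.withBool d) F π) (x.eval (M.withBool d) F π) y) := by
      refine iff_of_eq (congrArg (ρ' j) ((eval_extArgs _ _ _ _ _).trans ?_))
      have hinr : Terms.eval (M.withBool d) F (Terms.inr (Γ := ar j)) (Tup.append y π) = π :=
        Tup.right_append y π
      exact congr (congr (congrArg (extTup (decide (k < j)))
        ((Term.eval_subst _ _ _).trans (congrArg (fun e => b.eval _ F e) hinr)))
        ((Terms.eval_subst _ _ _).trans (congrArg (fun e => x.eval _ F e) hinr)))
        (Tup.left_append y π)
    cases guard with
    | none =>
      refine hcall.trans ⟨fun h => ⟨h, fun _ hb => ?_⟩, fun h => h.1⟩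
      rw [hnone rfl] at hb
      cases hb
    | some g =>
      by_cases hkj : k = j
      · subst hkj
        have h : callSubst k b x (some g) (.inl k) = .and call g := dif_pos rfl
        refine (iff_of_eq (congrArg (fun φ => Formula.eval (M.withBool d) F (joinInterp ρ' χ') φ
          (Tup.append y π)) h)).trans ((and_congr hcall (hsome g rfl y)).trans ?_)
        exact ⟨fun h => ⟨h.1, fun _ => h.2⟩, fun h => ⟨h.1, h.2 rfl⟩⟩
      · have h : callSubst k b x (some g) (.inl j) = call := dif_neg hkj
        refine (iff_of_eq (congrArg (fun φ => Formula.eval (M.withBool d) F (joinInterp ρ' χ') φ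
          (Tup.append y π)) h)).trans (hcall.trans ?_)
        exact ⟨fun h => ⟨h, fun h => absurd h hkj⟩, fun h => h.1⟩
  · exact iff_of_eq (congrArg (χ' (some r)) (Tup.left_append y π))

theorem eval_psubst_callSubst (b : Term L.withBool FV Θ none) (x : Terms L.withBool FV (ar k) Θ)
    (guard : Option (Formula L.withBool FV (stepVars ar W k) (ar k ++ Θ)))
    (hnone : guard = none → ∀ π, (b.eval (M.withBool d) F π).down = false)
    (hsome : ∀ g ∈ guard, ∀ π y,
      g.eval (M.withBool d) F (joinInterp ρ' χ') (Tup.append y π) ↔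
        ((b.eval (M.withBool d) F π).down = true →
          relOf (χ' none) (x.eval (M.withBool d) F π) y))
    (φ : Formula L.withBool FV (progVars ar W) Γ) (θ : Terms L.withBool FV Γ Δ)
    (π : Terms L.withBool FV Θ Δ) (e : Tup (M.withBool d).carrier Δ) :
    (φ.psubst (callSubst k b x guard) θ π).eval (M.withBool d) F (joinInterp ρ' χ') e ↔
      φ.eval (M.withBool d) F (joinInterp (pull k (relOf (χ' none))
        (b.eval (M.withBool d) F (π.eval (M.withBool d) F e))
        (x.eval (M.withBool d) F (π.eval (M.withBool d) F e)) ρ') (oldInterp χ'))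
        (θ.eval (M.withBool d) F e) := by
  rw [Formula.eval_psubst]
  refine iff_of_eq ?_
  congr 1
  funext X y
  exact propext (eval_callSubst b x guard _ (fun h => hnone h _) (fun g h => hsome g h _) X y)

theorem eval_psubst_sigmaZero (φ : Formula L.withBool FV (progVars ar W) Γ)
    (e : Tup (M.withBool d).carrier Γ) :
    (φ.psubst (sigmaZero k) Terms.id Tup.nil).eval (M.withBool d) F (joinInterp ρ' χ') e ↔
      φ.eval (M.withBool d) F (joinInterp (pull k (relOf (χ' none)) ⟨false⟩ (dummyTup d _) ρ')
        (oldInterp χ')) e := by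
  refine (eval_psubst_callSubst ffTerm (dummies _) none (fun _ _ => rfl) (fun _ h => by cases h)
    φ _ _ e).trans ?_
  rw [eval_dummies]
  rfl

theorem eval_wfAtom (x y : Terms L.withBool FV (ar k) Γ) (e : Tup (M.withBool d).carrier Γ) :
    (wfAtom k x y).eval (M.withBool d) F (joinInterp ρ' χ') e ↔
      relOf (χ' none) (x.eval (M.withBool d) F e) (y.eval (M.withBool d) F e) :=
  iff_of_eq (congrArg (χ' none) (Terms.eval_append x y e))

theorem eval_psubst_sigmaMu (φ : Formula L.withBool FV (progVars ar W) Γ)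
    (θ : Terms L.withBool FV Γ Δ) (π : Terms L.withBool FV (ar k) Δ)
    (e : Tup (M.withBool d).carrier Δ) :
    (φ.psubst (sigmaMu k) θ π).eval (M.withBool d) F (joinInterp ρ' χ') e ↔
      φ.eval (M.withBool d) F (joinInterp (pull k (relOf (χ' none)) ⟨true⟩
        (π.eval (M.withBool d) F e) ρ') (oldInterp χ')) (θ.eval (M.withBool d) F e) := by
  refine eval_psubst_callSubst ttTerm Terms.id (some (wfAtom k Terms.inr Terms.inl))
    (fun h => by cases h) ?_ φ _ _ e
  rintro g ⟨⟩ π y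
  have hinr : Terms.eval (M.withBool d) F (Terms.inr (Γ := ar k)) (Tup.append y π) = π :=
    Tup.right_append y π
  have hinl : Terms.eval (M.withBool d) F (Terms.inl (Γ := ar k)) (Tup.append y π) = y :=
    Tup.left_append y π
  rw [eval_wfAtom, hinr, hinl]
  exact ⟨fun h _ => h, fun h => h rfl⟩

theorem eval_psubst_sigmaNu (φ : Formula L.withBool FV (progVars ar W) Γ)
    (θ : Terms L.withBool FV Γ Δ) (π : Terms L.withBool FV (boolCtx (ar k)) Δ)
    (e : Tup (M.withBool d).carrier Δ) :
    (φ.psubst (sigmaNu k) θ π).eval (M.withBool d) F (joinInterp ρ' χ') e ↔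
      φ.eval (M.withBool d) F (joinInterp (pull k (relOf (χ' none))
        (π.eval (M.withBool d) F e _ .zero) (Tup.tail (π.eval (M.withBool d) F e)) ρ')
        (oldInterp χ')) (θ.eval (M.withBool d) F e) := by
  refine eval_psubst_callSubst (.var .zero) (fun _ z => .var z.succ) (some _)
    (fun h => by cases h) ?_ φ _ _ e
  rintro g ⟨⟩ π y
  refine (Formula.eval_imp _ _ _).trans (imp_congr (iff_of_eq ?_) ?_)
  · exact congrArg (fun π : Tup (M.withBool d).carrier (boolCtx (ar k)) =>
      (π _ .zero : ULift Bool).down = true) (Tup.right_append y π)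
  · refine (eval_wfAtom _ _ _).trans (iff_of_eq (congr (congrArg (relOf (χ' none)) ?_) ?_))
    · exact congrArg (Tup.tail (Γ := ar k)) (Tup.right_append y π)
    · exact Tup.left_append y π

theorem eval_stepBody_of_gt (hki : k < i) (φ : Formula L.withBool FV (progVars ar W) (ar i))
    (b : ULift.{v} Bool) (x : Tup (M.withBool d).carrier (ar k))
    (z : Tup (M.withBool d).carrier (ar i)) :
    (stepBody k i φ).eval (M.withBool d) F (joinInterp ρ' χ')
        (extTup (D := (M.withBool d).carrier) (decide (k < i)) b x z) ↔
      φ.eval (M.withBool d) F (joinInterp (pull k (relOf (χ' none)) b x ρ') (oldInterp χ')) z := by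
  unfold stepBody stepAr
  have hc := decide_eq_true hki
  generalize decide (k < i) = c at hc
  subst hc
  refine (eval_psubst_sigmaNu φ _ _ _).trans (iff_of_eq ?_)
  exact congr (congrArg (fun x => Formula.eval _ F
    (joinInterp (pull k (relOf (χ' none)) b x ρ') (oldInterp χ')) φ) (Tup.left_append x z))
    (Tup.right_append x z)

theorem eval_stepBody_self (φ : Formula L.withBool FV (progVars ar W) (ar k))
    (b : ULift.{v} Bool) (x z : Tup (M.withBool d).carrier (ar k)) :
    (stepBody k k φ).eval (M.withBool d) F (joinInterp ρ' χ')
        (extTup (D := (M.withBool d).carrier) (decide (k < k)) b x z) ↔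
      φ.eval (M.withBool d) F (joinInterp (pull k (relOf (χ' none)) ⟨true⟩ z ρ')
        (oldInterp χ')) z := by
  unfold stepBody stepAr
  have hc := decide_eq_false (lt_irrefl k)
  generalize decide (k < k) = c at hc
  subst hc
  simp only [extAr, extTup, dif_pos]
  exact eval_psubst_sigmaMu φ _ _ _

theorem eval_stepBody_of_lt (hik : i < k) (φ : Formula L.withBool FV (progVars ar W) (ar i))
    (b : ULift.{v} Bool) (x : Tup (M.withBool d).carrier (ar k))
    (z : Tup (M.withBool d).carrier (ar i)) :
    (stepBody k i φ).eval (M.withBool d) F (joinInterp ρ' χ')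
        (extTup (D := (M.withBool d).carrier) (decide (k < i)) b x z) ↔
      φ.eval (M.withBool d) F (joinInterp (pull k (relOf (χ' none)) ⟨false⟩ (dummyTup d _) ρ')
        (oldInterp χ')) z := by
  unfold stepBody stepAr
  have hc := decide_eq_false hik.not_gt
  generalize decide (k < i) = c at hc
  subst hc
  simp only [extAr, extTup, dif_neg hik.ne']
  exact eval_psubst_sigmaZero φ z

end Step

section Elimination

variable {L : Signature.{u}} {M : Struc.{u, v} L} {d : (s : L.Srt) → M.carrier s}
  {FV : FunVars L.withBool.Srt} {F : FInterp (M.withBool d) FV} {Γ : List L.withBool.Srt}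
  {m : ℕ} {W : PredVars L.withBool.Srt}

/-- Bodies and query are monotone in the defined predicates. -/
def Problem.Mono {L : Signature.{u}} {FV : FunVars L.Srt} {W : PredVars L.Srt} {Γ : List L.Srt}
    (A : Problem L FV W m Γ) (M : Struc.{u, v} L) (F : FInterp M FV) : Prop :=
  A.prog.Mono M F ∧ ∀ χ ρ ρ', ρ ≤ ρ' → ∀ e,
    A.query.eval M F (joinInterp ρ χ) e → A.query.eval M F (joinInterp ρ' χ) e

/-- At each tuple of arguments, a body after the step for `X k` is the body before the step, with
the predicates interpreted in a context `b'`, `x'` that depends on the position of the equation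
relative to the one of `X k`. -/
theorem exists_op_elimMuStep (k : Fin m) (A : Problem L.withBool FV W m Γ) (i : Fin m)
    (b : ULift.{v} Bool) (x : Tup (M.withBool d).carrier (A.prog.ar k))
    (z : Tup (M.withBool d).carrier (A.prog.ar i)) :
    ∃ (b' : ULift.{v} Bool) (x' : Tup (M.withBool d).carrier (A.prog.ar k)),
      (∀ χ' ρ', (elimMuStep k A).prog.op (M.withBool d) F χ' ρ' i
          (extTup (D := (M.withBool d).carrier) (decide (k < i)) b x z) ↔
        A.prog.op (M.withBool d) F (oldInterp χ')
          (pull k (relOf (χ' none)) b' x' ρ') i z) ∧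
      (k < i ∧ b' = b ∧ x' = x ∨
        (∃ h : i = k, b' = ⟨true⟩ ∧ x' = Tup.cast (congrArg A.prog.ar h) z) ∨
        i < k ∧ b' = ⟨false⟩ ∧ x' = dummyTup d _) := by
  rcases lt_trichotomy k i with hki | rfl | hik
  · exact ⟨b, x, fun χ' ρ' => eval_stepBody_of_gt hki _ b x z, .inl ⟨hki, rfl, rfl⟩⟩
  · exact ⟨⟨true⟩, z, fun χ' ρ' => eval_stepBody_self _ b x z, .inr (.inl ⟨rfl, rfl, rfl⟩)⟩
  · exact ⟨⟨false⟩, dummyTup d _, fun χ' ρ' => eval_stepBody_of_lt hik _ b x z,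
      .inr (.inr ⟨hik, rfl, rfl⟩)⟩

theorem exists_eq_extTup {ar : Fin m → List L.withBool.Srt} (k i : Fin m)
    (e : Tup (M.withBool d).carrier (stepAr ar k i)) :
    ∃ b x z, e = extTup (D := (M.withBool d).carrier) (decide (k < i)) b x z :=
  exists_extTup _ ⟨false⟩ (dummyTup d _) e

theorem Problem.Mono.step {A : Problem L.withBool FV W m Γ} (hA : A.Mono (M.withBool d) F)
    (k : Fin m) : (elimMuStep k A).Mono (M.withBool d) F := by
  constructor
  · intro χ' ρ ρ' hρ i e he
    obtain ⟨b, x, z, rfl⟩ := exists_eq_extTup k i e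
    obtain ⟨b', x', hop, -⟩ := exists_op_elimMuStep (F := F) k A i b x z
    exact (hop _ _).2 (hA.1 _ (pull_mono _ _ _ _ hρ) _ _ ((hop _ _).1 he))
  · intro χ' ρ ρ' hρ e he
    exact (eval_psubst_sigmaZero _ e).2 (hA.2 _ _ _ (pull_mono _ _ _ _ hρ) e
      ((eval_psubst_sigmaZero _ e).1 he))

/-! ### From a solution to validity -/

/-- The interpretation after the step for a least fixpoint `X k` is, in each context, below the
one before the step. At `X k` itself this is proved by induction along the well-founded relation:
in the body at the argument `y`, the guard restricts the calls of `X k` to smaller arguments. The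
context is arbitrary while only equations after that of `X k` are solved, and from `X k` on it is
the one of `σ₀`. -/
theorem pull_solve_elimMuStep_le {A : Problem L.withBool FV W m Γ}
    (hA : A.prog.Mono (M.withBool d) F) {k : Fin m} (hk : A.prog.kind k = .mu)
    {χ' : (r : (W.add (A.prog.ar k)).Idx) → Pred (M.withBool d)
      ((W.add (A.prog.ar k)).ar r ++ (W.add (A.prog.ar k)).ar r)}
    (hR : WellFounded fun y x => relOf (χ' none) x y) :
    ∀ (j : ℕ) (h : j ≤ m) (b : ULift.{v} Bool) (x : Tup (M.withBool d).carrier (A.prog.ar k)),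
      (m - j ≤ (k : ℕ) → b = ⟨false⟩ ∧ x = dummyTup d _) →
      ∀ (ρ' : (i : Fin m) → Pred (M.withBool d) (stepAr A.prog.ar k i))
        (ρ : (i : Fin m) → Pred (M.withBool d) (A.prog.ar i)),
      (∀ i : Fin m, (i : ℕ) < m - j → pull k (relOf (χ' none)) b x ρ' i ≤ ρ i) →
      pull k (relOf (χ' none)) b x ((elimMuStep k A).prog.solve (M.withBool d) F χ' j h ρ') ≤
        A.prog.solve (M.withBool d) F (oldInterp χ') j h ρ
  | 0, _, _, _, _, _, _, hρ => fun i => hρ i i.2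
  | j + 1, h, b, x, hc, ρ', ρ, hρ => by
    obtain ⟨n, hn⟩ : ∃ n : Fin m, (n : ℕ) = m - (j + 1) := ⟨⟨_, by omega⟩, rfl⟩
    rw [A.prog.solve_succ F _ h n hn]
    refine le_of_eq_of_le (congrArg (pull k (relOf (χ' none)) b x)
      ((elimMuStep k A).prog.solve_succ F χ' h n hn ρ')) ?_
    have hupdate : ∀ (b : ULift.{v} Bool) (x : Tup (M.withBool d).carrier (A.prog.ar k)),
        (∀ i : Fin m, (i : ℕ) < m - (j + 1) → pull k (relOf (χ' none)) b x ρ' i ≤ ρ i) →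
        ∀ (q' : Pred (M.withBool d) (stepAr A.prog.ar k n))
          (q : Pred (M.withBool d) (A.prog.ar n)),
        (∀ y, q' (extTup (D := (M.withBool d).carrier) (decide (k < n)) b x y) →
          (∀ h : k = n, b.down = true →
            relOf (χ' none) x (Tup.cast (congrArg A.prog.ar h.symm) y)) → q y) →
        ∀ i : Fin m, (i : ℕ) < m - j →
          pull k (relOf (χ' none)) b x (Function.update ρ' n q') i ≤ Function.update ρ n q i := by
      intro b x hρ q' q hq i hi
      by_cases hin : i = n
      · subst hin
        rw [Function.update_self]
        exact fun y hy => hq y ((congrFun (Function.update_self i q' ρ') _).mp hy.1) hy.2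
      · rw [Function.update_of_ne hin]
        intro y hy
        refine hρ i (by have := Fin.val_ne_of_ne hin; omega) y ⟨?_, hy.2⟩
        have := hy.1
        rwa [Function.update_of_ne hin] at this
    refine pull_solve_elimMuStep_le hA hk hR j _ b x (fun hj => hc (by omega)) _ _
      (hupdate b x hρ _ _ fun y hy _ => ?_)
    by_cases hnk : n = k
    · subst hnk
      have hkind : (elimMuStep n A).prog.kind n = .nu := Function.update_self _ _ _
      rw [hkind] at hy
      obtain ⟨q', hq', hy⟩ := FP_nu_apply.1 hy
      rw [hk]
      suffices H : ∀ y, q' (extTup (D := (M.withBool d).carrier) (decide (n < n)) b x y) →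
          FP .mu (fun q => A.prog.op (M.withBool d) F (oldInterp χ')
            (A.prog.solve (M.withBool d) F (oldInterp χ') j _ (Function.update ρ n q)) n) y from
        H y hy
      intro y
      induction y using hR.induction with
      | _ y ih =>
        intro hy
        refine (FP_eq (MuCLP.op_solve_mono hA _ h n hn ρ) .mu).le _ ?_
        refine hA _ (pull_solve_elimMuStep_le hA hk hR j _ ⟨true⟩ y (fun hj => by omega)
          (Function.update ρ' n q') _ (hupdate _ _ ?_ q' _ ?_)) _ _
          ((eval_stepBody_self _ b x y).1 (hq' _ hy))
        · intro i hi y' hy'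
          have hin : ¬ n < i := fun h => by
            have := Fin.lt_def.1 h
            omega
          refine hρ i hi y' ⟨?_, fun h => absurd (Fin.val_eq_of_eq h) (by omega)⟩
          rw [extTup_of_not hin b ⟨true⟩ x y y']
          exact hy'.1
        · intro y' hy' hR'
          exact ih y' (hR' rfl rfl)
            ((congrArg q' (extTup_of_not (lt_irrefl n) _ _ _ _ y')).mp hy')
    · have hkind : (elimMuStep k A).prog.kind n = A.prog.kind n := Function.update_of_ne hnk _ _
      rw [hkind] at hy
      refine FP_transport (extTup (D := (M.withBool d).carrier) (decide (k < n)) b x) ?_ _ y hy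
      intro q' q hq y hy
      obtain ⟨b', x', hop, hctx⟩ := exists_op_elimMuStep (F := F) k A n b x y
      obtain ⟨rfl, rfl⟩ : b' = b ∧ x' = x := by
        rcases hctx with ⟨-, h⟩ | ⟨h, -⟩ | ⟨hlt, rfl, rfl⟩
        · exact h
        · exact absurd h hnk
        · obtain ⟨rfl, rfl⟩ := hc (by have := Fin.lt_def.1 hlt; omega)
          exact ⟨rfl, rfl⟩
      refine hA _ (pull_solve_elimMuStep_le hA hk hR j _ b' x' (fun hj => hc (by omega)) _ _
        (hupdate b' x' hρ q' q fun y hy _ => hq y hy)) _ _ ((hop _ _).1 hy)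

/-- A solution of a problem with greatest fixpoints only: well-founded relations for the binary
variables, and predicates that satisfy the implications from left to right of all equations and
the query. -/
def Solvable {L : Signature.{u}} {FV : FunVars L.Srt} {Γ : List L.Srt} (M : Struc.{u, v} L)
    (F : FInterp M FV) (A : (W : PredVars L.Srt) × Problem L FV W m Γ) : Prop :=
  ∃ χ ρ, (∀ r, WellFounded fun y x => relOf (χ r) x y) ∧
    ρ ≤ A.2.prog.op M F χ ρ ∧
    ∀ e, A.2.query.eval M F (joinInterp ρ χ) e

theorem eval_query_of_eval_elimMuStep {A : Problem L.withBool FV W m Γ}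
    (hA : A.Mono (M.withBool d) F) {k : Fin m} (hk : A.prog.kind k = .mu)
    {χ' : (r : (W.add (A.prog.ar k)).Idx) → Pred (M.withBool d)
      ((W.add (A.prog.ar k)).ar r ++ (W.add (A.prog.ar k)).ar r)}
    (hR : WellFounded fun y x => relOf (χ' none) x y) {e : Tup (M.withBool d).carrier Γ}
    (he : (elimMuStep k A).query.eval (M.withBool d) F
      (joinInterp ((elimMuStep k A).prog.sem (M.withBool d) F χ') χ') e) :
    A.query.eval (M.withBool d) F
      (joinInterp (A.prog.sem (M.withBool d) F (oldInterp χ')) (oldInterp χ')) e :=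
  hA.2 _ _ _ (pull_solve_elimMuStep_le hA.1 hk hR m le_rfl _ _ (fun _ => ⟨rfl, rfl⟩) _ _
    fun i hi => absurd hi (by omega)) e ((eval_psubst_sigmaZero _ e).1 he)

/-- The induction over the elimination of the least fixpoint equations, from the solution of the
resulting problem back to the given one. -/
theorem eval_query_of_solvable_elimMuFrom : ∀ (n : ℕ) (h : n ≤ m) (W : PredVars L.withBool.Srt)
    (A : Problem L.withBool FV W m Γ), A.Mono (M.withBool d) F →
    (∀ i : Fin m, n ≤ (i : ℕ) → A.prog.kind i = .nu) →
    Solvable (M.withBool d) F (elimMuFrom n h W A) →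
    ∃ χ, (∀ r, WellFounded fun y x => relOf (χ r) x y) ∧ ∀ e, A.query.eval (M.withBool d) F
      (joinInterp (A.prog.sem (M.withBool d) F χ) χ) e
  | 0, _, _, A, hA, hν, ⟨χ, ρ, hwf, hρ, hq⟩ => ⟨χ, hwf, fun e => hA.2 _ _ _
      (MuCLP.le_solve_of_nu hA.1 (fun i => hν i (Nat.zero_le _)) hρ m le_rfl _
        fun i hi => absurd hi (by omega)) e (hq e)⟩
  | n + 1, h, W, A, hA, hν, hs => by
    rw [elimMuFrom] at hs
    split_ifs at hs with hk
    · have hν' : ∀ i : Fin m, n ≤ (i : ℕ) → (elimMuStep ⟨n, h⟩ A).prog.kind i = .nu := by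
        intro i hi
        by_cases hin : i = ⟨n, h⟩
        · subst hin
          exact Function.update_self _ _ _
        · refine (Function.update_of_ne hin _ _).trans (hν i ?_)
          have := Fin.val_ne_of_ne hin
          simp only at this
          omega
      obtain ⟨χ', hwf, hq⟩ := eval_query_of_solvable_elimMuFrom n _ _ _
        (hA.step ⟨n, h⟩) hν' hs
      exact ⟨oldInterp χ', fun r => hwf (some r),
        fun e => eval_query_of_eval_elimMuStep hA hk (hwf none) (hq e)⟩
    · refine eval_query_of_solvable_elimMuFrom n _ W A hA (fun i hi => ?_) hs
      rcases hi.eq_or_lt with hi | hi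
      · obtain rfl : i = ⟨n, h⟩ := Fin.ext hi.symm
        cases hi : A.prog.kind ⟨n, h⟩
        · exact absurd hi hk
        · rfl
      · exact hν i hi

/-! ### From validity to a solution -/

/-- A certificate of validity: predicates, with a signature for each atom, such that the bodies
rely only on atoms whose signature descends. -/
def Certified {L : Signature.{u}} {FV : FunVars L.Srt} {W : PredVars L.Srt} {Γ : List L.Srt}
    (M : Struc.{u, v} L) (F : FInterp M FV) (A : Problem L FV W m Γ) : Prop :=
  ∃ (χ : (r : W.Idx) → Pred M (W.ar r ++ W.ar r)) (ρ : (i : Fin m) → Pred M (A.prog.ar i))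
    (sig : (i : Fin m) → Tup M.carrier (A.prog.ar i) → Fin m → Ordinal.{max u v}),
    (∀ r, WellFounded fun y x => relOf (χ r) x y) ∧
    (∀ i z, ρ i z → A.prog.op M F χ
      (fun l y => ρ l y ∧ Descends A.prog.kind i l (sig l y) (sig i z)) i z) ∧
    ∀ e, A.query.eval M F (joinInterp ρ χ) e

/-- The part of an extended tuple that was there before the extension. -/
def unextTup {D : L.withBool.Srt → Type v} (c : Bool) {w u : List L.withBool.Srt}
    (e : Tup D (extAr c w u)) : Tup D u :=
  match c, e with
  | true, e => Tup.right (Γ := w) (Tup.tail e)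
  | false, e => e

theorem unextTup_extTup {D : L.withBool.Srt → Type v} (c : Bool) {w u : List L.withBool.Srt}
    (b : D (none : Option L.Srt)) (x : Tup D w) (y : Tup D u) :
    unextTup c (extTup c b x y) = y := by
  cases c with
  | false => rfl
  | true => exact Tup.right_append x y

/-- A certificate survives the elimination of a least fixpoint `X k`. The fresh relation compares
the signatures of the arguments of `X k` up to the component `k`; an atom of a later predicate is
kept in the context `⊤`, `x` if its signature is below that of `X k (x)` in this sense. -/
theorem Certified.step {A : Problem L.withBool FV W m Γ} (hA : A.Mono (M.withBool d) F)
    {k : Fin m} (hk : A.prog.kind k = .mu) (h : Certified (M.withBool d) F A) :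
    Certified (M.withBool d) F (elimMuStep k A) := by
  obtain ⟨χ, ρ, sig, hwf, hρ, hq⟩ := h
  let χ' : (r : (W.add (A.prog.ar k)).Idx) → Pred (M.withBool d)
      ((W.add (A.prog.ar k)).ar r ++ (W.add (A.prog.ar k)).ar r)
    | none => fun t => LtUpTo k (sig k (Tup.right (Γ := A.prog.ar k) t))
        (sig k (Tup.left (Γ := A.prog.ar k) t))
    | some r => χ r
  have hχ' : ∀ x y, relOf (χ' none) x y ↔ LtUpTo k (sig k y) (sig k x) := fun x y =>
    iff_of_eq (congr (congrArg (fun z z' => LtUpTo k (sig k z) (sig k z')) (Tup.right_append x y))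
      (Tup.left_append x y))
  let ρ' : (i : Fin m) → Pred (M.withBool d) (stepAr A.prog.ar k i) := fun i e =>
    ∃ b x z, e = extTup (D := (M.withBool d).carrier) (decide (k < i)) b x z ∧ ρ i z ∧
      (k < i → (b : ULift Bool).down = true → LtUpTo k (sig i z) (sig k x))
  let sig' : (i : Fin m) → Tup (M.withBool d).carrier (stepAr A.prog.ar k i) → Fin m →
      Ordinal.{max u v} := fun i e => sig i (unextTup (decide (k < i)) e)
  -- The invariant on the context `b`, `x` in which the atom `X l (y)` is used makes it true in
  -- the new problem, together with its guard if `l = k`.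
  have hpull : ∀ (b : ULift.{v} Bool) (x : Tup (M.withBool d).carrier (A.prog.ar k)) (l : Fin m)
      (y : Tup (M.withBool d).carrier (A.prog.ar l)) (Q : Fin m → (Fin m → Ordinal) → Prop),
      ρ l y → (k ≤ l → b.down = true → LtUpTo k (sig l y) (sig k x)) → Q l (sig l y) →
      pull k (relOf (χ' none)) b x (fun l e => ρ' l e ∧ Q l (sig' l e)) l y := by
    intro b x l y Q hy hlt hQ
    refine ⟨⟨⟨b, x, y, rfl, hy, fun hkl => hlt hkl.le⟩, ?_⟩, ?_⟩
    · exact (congrArg (Q l) (congrArg (sig l) (unextTup_extTup _ _ _ _))).mpr hQ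
    · rintro rfl hb
      exact (hχ' _ _).2 (hlt le_rfl hb)
  refine ⟨χ', ρ', sig', ?_, ?_, fun e => ?_⟩
  · rintro (_ | r)
    · exact Subrelation.wf (fun h => (hχ' _ _).1 h)
        (InvImage.wf (sig k) (wellFounded_ltUpTo k))
    · exact hwf r
  · rintro i _ ⟨b, x, z, rfl, hz, hlt⟩
    obtain ⟨b', x', hop, hctx⟩ := exists_op_elimMuStep (F := F) k A i b x z
    refine (hop _ _).2 (hA.1 _ (fun l y hy => ?_) _ _ (hρ i z hz))
    refine hpull b' x' l y (fun l s => Descends (elimMuStep k A).prog.kind i l s (sig' i _)) hy.1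
      (fun hkl hb => ?_) ?_
    · rcases hctx with ⟨hki, rfl, rfl⟩ | ⟨rfl, rfl, rfl⟩ | ⟨hik, rfl, rfl⟩
      · exact (hy.2.1.of_le (le_min hki.le hkl)).trans_lt (hlt hki hb)
      · have := hy.2.2 hk hkl
        rwa [min_eq_left hkl] at this
      · cases hb
    · rw [show sig' i _ = sig i z from congrArg (sig i) (unextTup_extTup _ _ _ _)]
      refine ⟨hy.2.1, fun hi => hy.2.2 ?_⟩
      by_cases hik : i = k
      · rw [hik, hk]
      · exact (Function.update_of_ne hik _ _).symm.trans hi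
  · refine (eval_psubst_sigmaZero _ e).2 (hA.2 _ _ _ (fun l y hy => ?_) e (hq e))
    have := hpull ⟨false⟩ (dummyTup d _) l y (fun _ _ => True) hy (fun _ hb => by cases hb) trivial
    exact ⟨this.1.1, this.2⟩

theorem Certified.solvable_elimMuFrom : ∀ (n : ℕ) (h : n ≤ m) (W : PredVars L.withBool.Srt)
    (A : Problem L.withBool FV W m Γ), A.Mono (M.withBool d) F →
    Certified (M.withBool d) F A → Solvable (M.withBool d) F (elimMuFrom n h W A)
  | 0, _, _, A, hA, ⟨χ, ρ, sig, hwf, hρ, hq⟩ =>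
    ⟨χ, ρ, hwf, fun i z hz => hA.1 χ (fun _ _ hy => hy.1) _ _ (hρ i z hz), hq⟩
  | n + 1, h, W, A, hA, hc => by
    rw [elimMuFrom]
    split_ifs with hk
    · exact solvable_elimMuFrom n _ _ _ (hA.step ⟨n, h⟩) (hc.step hA hk)
    · exact solvable_elimMuFrom n _ W A hA hc

end Elimination

/-! ### The clauses of the reduction -/

section Reduct

theorem isWF_iff {L : Signature.{u}} {M : Struc.{u, v} L} {m : ℕ} {ar : Fin m → List L.Srt}
    {W : PredVars L.Srt} (ρ : PInterp M (progVars ar W)) (r : W.Idx) :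
    IsWF ρ (.inr r) ↔ WellFounded fun y x => relOf (ρ (.inr r)) x y := by
  rw [wellFounded_iff_isEmpty_descending_chain, isEmpty_subtype]
  constructor
  · rintro ⟨w, h, H⟩ e he
    obtain rfl : W.ar r = w := by
      have h' : W.ar r ++ W.ar r = w ++ w := h
      have hlen := congrArg List.length h'
      simp only [List.length_append] at hlen
      exact List.append_inj_left h' (by omega)
    exact H ⟨e, he⟩
  · exact fun H => ⟨W.ar r, rfl, fun ⟨e, he⟩ => H e he⟩

namespace Formula

variable {L : Signature.{u}} {FV : FunVars L.withBool.Srt} {m : ℕ}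
  {W : PredVars L.withBool.Srt} {Θ : List L.withBool.Srt} {ar : Fin m → List L.withBool.Srt}
  {k : Fin m}

theorem isUniversal_callSubst (b : Term L.withBool FV Θ none)
    (x : Terms L.withBool FV (ar k) Θ)
    (guard : Option (Formula L.withBool FV (stepVars ar W k) (ar k ++ Θ)))
    (hguard : ∀ g ∈ guard, ∀ c, g.IsUniversal c) (X : (progVars ar W).Idx) (c : Bool) :
    (callSubst k b x guard X).IsUniversal c := by
  rcases X with j | r
  · cases guard with
    | none => trivial
    | some g =>
      by_cases hkj : k = j
      · subst hkj
        have h : callSubst k b x (some g) (.inl k) = .and _ g := dif_pos rfl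
        exact (congrArg (IsUniversal c) h).mpr ⟨trivial, hguard g rfl c⟩
      · have h : callSubst k b x (some g) (.inl j) = .pvar _ _ := dif_neg hkj
        exact (congrArg (IsUniversal c) h).mpr trivial
  · trivial

theorem IsUniversal.psubst_sigmaZero {Γ : List L.withBool.Srt}
    {φ : Formula L.withBool FV (progVars ar W) Γ} {c : Bool} (h : φ.IsUniversal c) :
    (φ.psubst (sigmaZero k) Terms.id Tup.nil).IsUniversal c :=
  h.psubst (isUniversal_callSubst _ _ none fun _ h => by cases h) _ _

theorem IsUniversal.stepBody {i : Fin m} {φ : Formula L.withBool FV (progVars ar W) (ar i)}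
    {c : Bool} (h : φ.IsUniversal c) : (stepBody k i φ).IsUniversal c := by
  unfold MuVal.stepBody stepAr
  generalize decide (k < i) = c'
  cases c' with
  | true =>
    refine h.psubst (isUniversal_callSubst _ _ (some _) ?_) _ _
    rintro g ⟨⟩ c
    exact ⟨trivial, trivial⟩
  | false =>
    by_cases hki : k = i
    · subst hki
      simp only [dif_pos]
      refine h.psubst (isUniversal_callSubst _ _ (some _) ?_) _ _
      rintro g ⟨⟩ c
      trivial
    · simp only [dif_neg hki]
      exact h.psubst_sigmaZero

end Formula

/-- Query and bodies contain no positive existential and no negative universal quantifier. -/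
def Problem.IsUniversal {L : Signature.{u}} {FV : FunVars L.Srt} {W : PredVars L.Srt} {m : ℕ}
    {Γ : List L.Srt} (A : Problem L FV W m Γ) : Prop :=
  A.query.IsUniversal true ∧ ∀ i, (A.prog.body i).IsUniversal true

theorem Problem.IsUniversal.elimMuFrom {L : Signature.{u}} {FV : FunVars L.withBool.Srt} {m : ℕ}
    {Γ : List L.withBool.Srt} : ∀ (n : ℕ) (h : n ≤ m) (W : PredVars L.withBool.Srt)
    (A : Problem L.withBool FV W m Γ), A.IsUniversal → (elimMuFrom n h W A).2.IsUniversal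
  | 0, _, _, _, hA => hA
  | n + 1, h, W, A, hA => by
    by_cases hk : A.prog.kind ⟨n, h⟩ = .mu
    · rw [MuVal.elimMuFrom, if_pos hk]
      exact elimMuFrom n _ _ (elimMuStep ⟨n, h⟩ A)
        ⟨hA.1.psubst_sigmaZero, fun i => (hA.2 i).stepBody⟩
    · rw [MuVal.elimMuFrom, if_neg hk]
      exact elimMuFrom n _ W A hA

theorem forall_elimNu_iff {L : Signature.{u}} {M : Struc.{u, v} L} {FV : FunVars L.Srt}
    {F : FInterp M FV} {W : PredVars L.Srt} {m : ℕ} {Γ : List L.Srt} {A : Problem L FV W m Γ}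
    (hA : A.IsUniversal) (ρ : (i : Fin m) → Pred M (A.prog.ar i))
    (χ : (r : W.Idx) → Pred M (W.ar r ++ W.ar r)) :
    (∀ c ∈ elimNu A, ∀ e, c.clause.eval M F (joinInterp ρ χ) e) ↔
      (∀ e, A.query.eval M F (joinInterp ρ χ) e) ∧ ρ ≤ A.prog.op M F χ ρ := by
  simp only [elimNu, List.mem_append, List.mem_flatMap, List.mem_finRange, true_and, or_imp,
    forall_and, forall_exists_index]
  refine and_congr (Formula.forall_cnf_iff hA.1) ?_
  rw [forall_comm]
  refine forall_congr' fun i => ?_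
  refine (Formula.forall_cnf_iff (φ := .imp (.pvar (PV := progVars A.prog.ar W) (.inl i) Terms.id)
    (A.prog.body i)) ⟨trivial, hA.2 i⟩).trans (forall_congr' fun e => ?_)
  exact Formula.eval_imp _ _ _

theorem exists_isSolution_elimNu_iff {L : Signature.{u}} {M : Struc.{u, v} L} {FV : FunVars L.Srt}
    {F : FInterp M FV} {m : ℕ} {Γ : List L.Srt}
    (A : (W : PredVars L.Srt) × Problem L FV W m Γ) (hA : A.2.IsUniversal) :
    (∃ ρ, PCSP.IsSolution (PV := progVars A.2.prog.ar A.1)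
      ⟨elimNu A.2, Set.range Sum.inr⟩ M F ρ) ↔ Solvable M F A := by
  constructor
  · rintro ⟨ρ, hcl, hwf⟩
    obtain ⟨ρ, χ, rfl⟩ : ∃ ρ' χ, ρ = joinInterp ρ' χ :=
      ⟨fun i => ρ (.inl i), fun r => ρ (.inr r), by funext X; cases X <;> rfl⟩
    obtain ⟨hq, hρ⟩ := (forall_elimNu_iff hA ρ χ).1 hcl
    exact ⟨χ, ρ, fun r => (isWF_iff (joinInterp ρ χ) r).1 (hwf _ ⟨r, rfl⟩), hρ, hq⟩
  · rintro ⟨χ, ρ, hwf, hρ, hq⟩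
    refine ⟨joinInterp ρ χ, (forall_elimNu_iff hA ρ χ).2 ⟨hq, hρ⟩, ?_⟩
    rintro _ ⟨r, rfl⟩
    exact (isWF_iff (joinInterp ρ χ) r).2 (hwf r)

variable {L : Signature.{u}} {M : Struc.{u, v} L} {m : ℕ}

/-- The problem after Skolemization. -/
abbrev skolemProblem {Γ : List L.Srt} (P : ClosedMuCLP L m) (φ : P.Query Γ) :
    Problem L (SkolemVar L.Srt m) (noPV L.Srt) m Γ :=
  ⟨elimExProg P, elimExQuery φ⟩

theorem mono_skolemProblem {Γ : List L.Srt} {P : ClosedMuCLP L m}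
    (hP : ∀ i, (P.body i).Positive) {φ : P.Query Γ} (hφ : φ.Positive)
    (F : FInterp M (SkolemVar L.Srt m)) : (skolemProblem P φ).Mono M F := by
  refine ⟨MuCLP.mono_of_positive (P := elimExProg P) (fun i => (hP i).skolem _) F,
    fun χ ρ ρ' hρ e => ?_⟩
  refine Formula.Positive.eval_mono (hφ.skolem _) ?_
  rintro (j | r)
  · exact hρ j
  · exact le_rfl

theorem ClosedMuCLP.Models.certified {Γ : List L.Srt} {P : ClosedMuCLP L m}
    (hP : ∀ i, (P.body i).Positive) {φ : P.Query Γ} (h : P.Models M φ) :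
    ∃ F, Certified M F (skolemProblem P φ) := by
  obtain ⟨sig, -, hsig⟩ := MuCLP.exists_signature
    (MuCLP.mono_of_positive hP fun _ _ f => f.elim) (fun r => Empty.elim r) m le_rfl
    fun _ _ => False
  obtain ⟨F, hF, hFφ⟩ := exists_skolem_functions (fun _ _ f => f.elim) φ
    (fun i z => joinInterp (W := noPV L.Srt) (fun l y =>
      P.sem M (fun _ _ f => f.elim) (fun r => Empty.elim r) l y ∧
        Descends P.kind i l (sig l y) (sig i z)) fun r => Empty.elim r)
    (joinInterp (W := noPV L.Srt) (P.sem M (fun _ _ f => f.elim) fun r => Empty.elim r)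
      fun r => Empty.elim r)
  refine ⟨F, fun r => Empty.elim r, P.sem M (fun _ _ f => f.elim) fun r => Empty.elim r, sig,
    fun r => Empty.elim r, fun i z hz => hF i z ?_, fun e => hFφ e (h e)⟩
  exact MuCLP.mono_of_positive hP _ _ (fun l y hy => ⟨hy.1, hy.2 (by omega)⟩) i _
    (hsig i (by omega) z hz)

theorem models_of_eval_skolemProblem {Γ : List L.Srt} {P : ClosedMuCLP L m}
    (hP : ∀ i, (P.body i).Positive) {φ : P.Query Γ} (hφ : φ.Positive)
    {F : FInterp M (SkolemVar L.Srt m)}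
    (χ : (r : Empty) → Pred M ((noPV L.Srt).ar r ++ (noPV L.Srt).ar r))
    (h : ∀ e, (skolemProblem P φ).query.eval M F
      (joinInterp (W := noPV L.Srt) ((skolemProblem P φ).prog.sem M F χ) χ) e) :
    P.Models M φ := by
  obtain rfl : χ = fun r => Empty.elim r := funext fun r => r.elim
  intro e
  refine hφ.eval_mono ?_ (eval_of_eval_elimExQuery (h e))
  rintro (i | r)
  · exact sem_elimExProg_le (MuCLP.mono_of_positive hP _) F _ i
  · exact le_rfl

end Reduct

end MuVal

theorem mainTheorem1 {L : MuVal.Signature.{u}} (M : MuVal.Struc.{u, v} L)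
    (d : (s : L.Srt) → M.carrier s) {m : ℕ} (P : MuVal.ClosedMuCLP L m)
    (hP : ∀ i, (P.body i).Positive) {Γ : List L.Srt} (φ : P.Query Γ) (hφ : φ.Positive) :
    (∃ F ρ, (MuVal.reduct P φ).IsSolution (M.withBool d) F ρ) ↔ P.Models M φ := by
  have hP' : ∀ i, (P.toBool.body i).Positive := fun i => (hP i).toBool
  have hφ' : MuVal.Formula.Positive (PV := MuVal.progVars P.toBool.ar _) φ.toBool := hφ.toBool
  have huniv : (MuVal.skolemProblem P.toBool φ.toBool).IsUniversal :=
    ⟨MuVal.Formula.isUniversal_skolem _ _ _ _, fun i =>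
      MuVal.Formula.isUniversal_skolem _ _ _ _⟩
  have hsolve : ∀ F, (∃ ρ, (MuVal.reduct P φ).IsSolution (M.withBool d) F ρ) ↔
      MuVal.Solvable (M.withBool d) F
        (MuVal.elimMuFrom m le_rfl _ (MuVal.skolemProblem P.toBool φ.toBool)) := fun F =>
    MuVal.exists_isSolution_elimNu_iff (MuVal.nuProblem P φ) (huniv.elimMuFrom m le_rfl _ _)
  rw [← MuVal.ClosedMuCLP.models_toBool P φ d]
  simp only [hsolve]
  constructor
  · rintro ⟨F, hF⟩
    obtain ⟨χ, -, hq⟩ := MuVal.eval_query_of_solvable_elimMuFrom m le_rfl _ _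
      (MuVal.mono_skolemProblem hP' hφ' F) (fun i hi => absurd i.2 hi.not_gt) hF
    exact MuVal.models_of_eval_skolemProblem hP' hφ' χ hq
  · intro h
    obtain ⟨F, hF⟩ := MuVal.ClosedMuCLP.Models.certified hP' h
    exact ⟨F, hF.solvable_elimMuFrom m le_rfl _ _ (MuVal.mono_skolemProblem hP' hφ' F)⟩
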